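/- Let $E$ be a (real) Banach lattice, and let $E^*$ be its norm dual with the dual norm and the order $f\le g \iff f(x)\le g(x)$ for all $x\ge 0$ in $E$. A bilinear form $A\colon E\times E\to\mathbb R$ is positive if $A(x,y)\ge 0$ whenever $x,y\ge 0$, and symmetric if $A(x,y)=A(y,x)$; a linear operator $T\colon E\to E^*$ is positive if $Tx\ge 0$ whenever $x\ge 0$. (Positive forms and operators are automatically bounded.) For a bounded bilinear map $A\colon X\times Y\to Z$ of Banach spaces, the Arens adjoint $A^*\colon Z^*\times X\to Y^*$ is $A^*(z^*,x)(y)=z^*(A(x,y))$, and $A^{***}\colon X^{**}\times Y^{**}\to Z^{**}$ is obtained by iterating this three times; for $X=Y$, the transpose is $A^t(x,y)=A(y,x)$, and $A$ is Arens regular if $A^{t***t}=A^{***}$. An operator is weakly compact if it maps the closed unit ball to a relatively weakly compact set. Then the following are equivalent: 1. $E^*$ has order continuous norm, i.e. $\|f_\alpha\|\to 0$ for every net $f_\alpha\downarrow 0$ in $E^*$; 2. $E$ contains no sublattice isomorphic to $\ell_1$, i.e. there is no linear subspace of $E$ that is closed under the lattice operations of $E$ and is the image of $\ell_1$ (with its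 usual norm and coordinatewise order) under a linear homeomorphism that is also an order isomorphism; 3. every positive bilinear form $A\colon E\times E\to\mathbb R$ is Arens regular; 4. every positive linear operator $T\colon E\to E^*$ is weakly compact; 5. every positive symmetric bilinear form $A\colon E\times E\to\mathbb R$ is Arens regular. -/

import Mathlib

set_option maxSynthPendingDepth 4

open Filter Topology

/-- The canonical order on the dual `E*` of an ordered normed space: `f ≤ g` iff
`f x ≤ g x` for all `x ≥ 0`. -/
instance strongDualPartialOrder (E : Type*) [NormedAddCommGroup E] [NormedSpace ℝ E] [Lattice E]
    [IsOrderedAddMonoid E] : PartialOrder (StrongDual ℝ E) where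
  le f g := ∀ x : E, 0 ≤ x → f x ≤ g x
  le_refl _ _ _ := le_rfl
  le_trans _ _ _ h₁ h₂ x hx := (h₁ x hx).trans (h₂ x hx)
  le_antisymm f g h₁ h₂ := by
    have key : ∀ x : E, 0 ≤ x → f x = g x := fun x hx => le_antisymm (h₁ x hx) (h₂ x hx)
    ext x
    rw [← posPart_sub_negPart x, map_sub, map_sub, key _ (posPart_nonneg x),
      key _ (negPart_nonneg x)]

/-- The norm of `X` is order continuous: whenever a net decreases to `0` (in order), its norms
tend to `0`. A decreasing net is a downward directed set, indexed by itself. -/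
def HasOrderContinuousNorm (X : Type*) [NormedAddCommGroup X] [PartialOrder X] : Prop :=
  ∀ D : Set X, D.Nonempty → DirectedOn (· ≥ ·) D → IsGLB D 0 →
    Tendsto (fun x : D => ‖(x : X)‖) atBot (𝓝 0)

/-- `E` contains a sublattice isomorphic to `ℓ₁`: a linear subspace `F` closed under the lattice
operations of `E` and a linear homeomorphism of `ℓ₁` (with its norm and its coordinatewise order)
onto `F` that is an order isomorphism. -/
def ContainsEllOneSublattice (E : Type*) [NormedAddCommGroup E] [NormedSpace ℝ E]
    [Lattice E] : Prop :=
  ∃ F : Submodule ℝ E,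
    (∀ x ∈ F, ∀ y ∈ F, x ⊔ y ∈ F ∧ x ⊓ y ∈ F) ∧
    ∃ e : lp (fun _ : ℕ => ℝ) 1 ≃L[ℝ] F,
      ∀ x y : lp (fun _ : ℕ => ℝ) 1, (∀ n, x n ≤ y n) ↔ (e x : E) ≤ (e y : E)

section Arens

variable {X Y Z : Type*} [NormedAddCommGroup X] [NormedSpace ℝ X]
  [NormedAddCommGroup Y] [NormedSpace ℝ Y] [NormedAddCommGroup Z] [NormedSpace ℝ Z]

/-- The Arens adjoint `A* : Z* × X → Y*` of a bounded bilinear map `A : X × Y → Z`,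
`A*(z*, x)(y) = z*(A(x, y))`. -/
noncomputable def arensAdjoint (A : X →L[ℝ] Y →L[ℝ] Z) :
    StrongDual ℝ Z →L[ℝ] X →L[ℝ] StrongDual ℝ Y :=
  ((ContinuousLinearMap.compL ℝ X (Y →L[ℝ] Z) (StrongDual ℝ Y)).flip A).comp
    (ContinuousLinearMap.compL ℝ Y Z ℝ)

theorem arensAdjoint_apply (A : X →L[ℝ] Y →L[ℝ] Z) (z' : StrongDual ℝ Z) (x : X) (y : Y) :
    arensAdjoint A z' x y = z' (A x y) := rfl

/-- The third Arens adjoint `A*** : X** × Y** → Z**`. -/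
noncomputable def arensExtension (A : X →L[ℝ] Y →L[ℝ] Z) :
    StrongDual ℝ (StrongDual ℝ X) →L[ℝ] StrongDual ℝ (StrongDual ℝ Y) →L[ℝ]
      StrongDual ℝ (StrongDual ℝ Z) :=
  arensAdjoint (arensAdjoint (arensAdjoint A))

end Arens

/-- A bilinear form `A` on `X × X` is Arens regular: it is bounded and `(Aᵗ)***ᵗ = A***`, where
`ᵗ` (here `flip`) is the transpose. -/
def IsArensRegular {X : Type*} [NormedAddCommGroup X] [NormedSpace ℝ X]
    (A : X →ₗ[ℝ] X →ₗ[ℝ] ℝ) : Prop :=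
  ∃ B : X →L[ℝ] X →L[ℝ] ℝ, (∀ x y, B x y = A x y) ∧
    (arensExtension B.flip).flip = arensExtension B

/-- A linear operator is weakly compact: it maps the closed unit ball onto a set whose closure in
the weak topology is weakly compact. -/
def IsWeaklyCompactOperator {X Y : Type*} [NormedAddCommGroup X] [NormedSpace ℝ X]
    [NormedAddCommGroup Y] [NormedSpace ℝ Y] (T : X →ₗ[ℝ] Y) : Prop :=
  IsCompact (closure (toWeakSpace ℝ Y '' (T '' Metric.closedBall (0 : X) 1)))

/-! ### Disjointness and decomposition in vector lattices. -/

section LatticeLemmas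

variable {E : Type*} [AddCommGroup E] [Lattice E] [IsOrderedAddMonoid E]

/-! Everything passes through the absence of an `ℓ₁`-sublattice.

If `E` does contain one, Hahn–Banach and band components give a bounded sequence `x n` and
biorthogonal positive functionals `ψ n` whose finite sums stay below a single `φ`
(`exists_biorthogonal_of_containsEllOneSublattice`). The tails of `∑ ψ n` decrease to `0` but equal
at least `1` at some `x n`, so the dual norm is not order continuous. Weighting `ψ i ⊗ ψ j` by a
symmetric half graph gives a positive symmetric form whose two iterated limits are `1` and `0`; this
defeats both Arens regularity and weak compactness.

If `E` contains none, disjointification shows that each positive functional is uniformly small on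
the part of a ball lying above some `u` (`exists_approx_order_bound`). Order continuity of the dual
norm follows by splitting at `u`. For Arens regularity, elements of the bidual are differences of
limits of bounded positive nets, and truncation reduces the question to nets in order intervals
(`IsBidualLimit.exists_truncation`). There every positive form is regular, by an energy decrement
(`bidual_eq_of_order_bounded`): for `0 ≤ a ≤ u` the functional `B a` acts like a density in `[0, 1]`
with respect to `B u`, and unequal iterated limits would let midpoints lower a nonnegative
`L²`-energy by a fixed amount forever.

Finally, regularity makes the extension of the operator to the bidual weak*-to-weak continuous,
whence weak compactness. -/

theorem inf_add_le_inf_add_inf {x y z : E} (hx : 0 ≤ x) (hy : 0 ≤ y) (hz : 0 ≤ z) :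
    x ⊓ (y + z) ≤ x ⊓ y + x ⊓ z := by
  have h : x ⊓ (y + z) - x ⊓ z ≤ x ⊓ y := by
    rw [sub_inf]
    refine sup_le (le_inf ?_ ?_) (le_inf ?_ ?_)
    · exact (sub_nonpos.2 inf_le_left).trans hx
    · exact (sub_nonpos.2 inf_le_left).trans hy
    · exact (sub_le_self _ hz).trans inf_le_left
    · rw [sub_le_iff_le_add]; exact inf_le_right
  exact sub_le_iff_le_add.1 h

theorem inf_add_eq_zero {x y z : E} (hx : 0 ≤ x) (hy : 0 ≤ y) (hz : 0 ≤ z)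
    (hxy : x ⊓ y = 0) (hxz : x ⊓ z = 0) : x ⊓ (y + z) = 0 :=
  le_antisymm ((inf_add_le_inf_add_inf hx hy hz).trans (by simp [hxy, hxz]))
    (le_inf hx (add_nonneg hy hz))

theorem inf_sum_eq_zero {ι : Type*} {x : E} (hx : 0 ≤ x) (s : Finset ι) (y : ι → E)
    (hy : ∀ i ∈ s, 0 ≤ y i) (h : ∀ i ∈ s, x ⊓ y i = 0) : x ⊓ ∑ i ∈ s, y i = 0 := by
  classical
  induction s using Finset.induction_on with
  | empty => simpa using hx
  | insert a s ha ih =>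
    rw [Finset.sum_insert ha]
    simp only [Finset.mem_insert, forall_eq_or_imp] at hy h
    exact inf_add_eq_zero hx hy.1 (Finset.sum_nonneg hy.2) h.1 (ih hy.2 h.2)

/-- From `a ⊓ b + a ⊔ b = a + b`, a sum of disjoint positive elements is their supremum. -/
theorem sum_le_of_disjoint {ι : Type*} {x : E} (hx : 0 ≤ x) (s : Finset ι) (y : ι → E)
    (hy : ∀ i ∈ s, 0 ≤ y i) (hd : ∀ i ∈ s, ∀ j ∈ s, i ≠ j → y i ⊓ y j = 0)
    (h : ∀ i ∈ s, y i ≤ x) : ∑ i ∈ s, y i ≤ x := by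
  classical
  induction s using Finset.induction_on with
  | empty => simpa using hx
  | insert a s ha ih =>
    rw [Finset.sum_insert ha]
    have hdis : y a ⊓ ∑ i ∈ s, y i = 0 := by
      refine inf_sum_eq_zero (hy a (by simp)) s y (fun i hi => hy i (by simp [hi])) fun i hi =>
        hd a (by simp) i (by simp [hi]) ?_
      rintro rfl
      exact ha hi
    have hsup := inf_add_sup (y a) (∑ i ∈ s, y i)
    rw [hdis, zero_add] at hsup
    rw [← hsup]
    exact sup_le (h a (by simp)) (ih (fun i hi => hy i (by simp [hi]))
      (fun i hi j hj => hd i (by simp [hi]) j (by simp [hj])) fun i hi => h i (by simp [hi]))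

/-- The Riesz decomposition property for finite sums. -/
theorem exists_riesz_decomposition {ι : Type*} (s : Finset ι) (w : ι → E) (hw : ∀ i, 0 ≤ w i)
    {b : E} (hb : 0 ≤ b) (h : b ≤ ∑ i ∈ s, w i) :
    ∃ c : ι → E, (∀ i, 0 ≤ c i ∧ c i ≤ w i) ∧ ∑ i ∈ s, c i = b := by
  classical
  induction s using Finset.induction_on generalizing b with
  | empty =>
    refine ⟨fun _ => 0, fun i => ⟨le_rfl, hw i⟩, ?_⟩
    simpa using le_antisymm hb (by simpa using h)
  | insert a s ha ih =>
    rw [Finset.sum_insert ha] at h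
    have h' : b - b ⊓ w a ≤ ∑ i ∈ s, w i := by
      rw [sub_inf]
      refine sup_le ?_ (by rwa [sub_le_iff_le_add'])
      simpa using Finset.sum_nonneg fun i _ => hw i
    obtain ⟨c, hc, hcs⟩ := ih (sub_nonneg.2 inf_le_left) h'
    refine ⟨Function.update c a (b ⊓ w a), fun i => ?_, ?_⟩
    · by_cases hi : i = a
      · subst hi; simp [hb, hw i]
      · simpa [hi] using hc i
    · rw [Finset.sum_insert ha, Finset.sum_congr rfl (g := c)]
      · simp [hcs]
      · intro i hi
        have : i ≠ a := by rintro rfl; exact ha hi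
        simp [this]

/-- Free of subtraction, so that a map additive only on the cone can be applied to both sides. -/
theorem posPart_add_add_negPart_add_negPart (x y : E) :
    (x + y)⁺ + (x⁻ + y⁻) = (x + y)⁻ + (x⁺ + y⁺) := by
  have h1 := posPart_sub_negPart (x + y)
  have h2 := posPart_sub_negPart x
  have h3 := posPart_sub_negPart y
  rw [← sub_eq_zero]
  calc _ = ((x + y)⁺ - (x + y)⁻) - (x⁺ - x⁻) - (y⁺ - y⁻) := by abel
    _ = 0 := by rw [h1, h2, h3]; abel

theorem posPart_sub_eq_sub_inf (x u : E) : (x - u)⁺ = x - x ⊓ u := by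
  rw [inf_eq_sub_posPart_sub]; abel

theorem posPart_eq_of_inf_eq_zero {p q : E} (h : p ⊓ q = 0) : (p - q)⁺ = p := by
  rw [posPart_sub_eq_sub_inf, h, sub_zero]

variable [Module ℝ E] [IsOrderedModule ℝ E]

omit [IsOrderedAddMonoid E] in
theorem inf_smul_le_smul_inf {x y : E} {c : ℝ} (hc : 0 < c) : (c • x) ⊓ (c • y) ≤ c • (x ⊓ y) := by
  have h : c⁻¹ • ((c • x) ⊓ (c • y)) ≤ x ⊓ y := by
    refine le_inf ?_ ?_
    · calc _ ≤ c⁻¹ • (c • x) := smul_le_smul_of_nonneg_left inf_le_left (by positivity)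
        _ = x := by rw [smul_smul, inv_mul_cancel₀ hc.ne', one_smul]
    · calc _ ≤ c⁻¹ • (c • y) := smul_le_smul_of_nonneg_left inf_le_right (by positivity)
        _ = y := by rw [smul_smul, inv_mul_cancel₀ hc.ne', one_smul]
  have := smul_le_smul_of_nonneg_left h hc.le
  rwa [smul_smul, mul_inv_cancel₀ hc.ne', one_smul] at this

theorem smul_inf_smul_eq_zero {x y : E} (hx : 0 ≤ x) (hy : 0 ≤ y) (h : x ⊓ y = 0) {a b : ℝ}
    (ha : 0 ≤ a) (hb : 0 ≤ b) : (a • x) ⊓ (b • y) = 0 := by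
  refine le_antisymm ?_ (le_inf (smul_nonneg ha hx) (smul_nonneg hb hy))
  have hc : 0 < a + b + 1 := by positivity
  calc (a • x) ⊓ (b • y) ≤ ((a + b + 1) • x) ⊓ ((a + b + 1) • y) :=
        inf_le_inf (smul_le_smul_of_nonneg_right (by linarith) hx)
          (smul_le_smul_of_nonneg_right (by linarith) hy)
    _ ≤ (a + b + 1) • (x ⊓ y) := inf_smul_le_smul_inf hc
    _ = 0 := by rw [h, smul_zero]

end LatticeLemmas

/-! ### Automatic continuity, extension from the cone, and band components. -/

section PositiveFunctionals

variable {E : Type*} [NormedAddCommGroup E] [NormedSpace ℝ E] [Lattice E]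
  [IsOrderedAddMonoid E] [IsOrderedModule ℝ E] [HasSolidNorm E]

omit [NormedSpace ℝ E] [IsOrderedModule ℝ E] in
theorem norm_le_norm_of_nonneg_of_le {a b : E} (ha : 0 ≤ a) (hab : a ≤ b) : ‖a‖ ≤ ‖b‖ :=
  norm_le_norm_of_abs_le_abs (by rwa [abs_of_nonneg ha, abs_of_nonneg (ha.trans hab)])

omit [NormedSpace ℝ E] [IsOrderedModule ℝ E] in
theorem norm_posPart_le (x : E) : ‖x⁺‖ ≤ ‖x‖ := by
  rw [← norm_abs_eq_norm x]
  exact norm_le_norm_of_nonneg_of_le (posPart_nonneg x)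
    (by rw [← posPart_add_negPart]; exact le_add_of_nonneg_right (negPart_nonneg x))

omit [NormedSpace ℝ E] [IsOrderedModule ℝ E] in
theorem norm_negPart_le (x : E) : ‖x⁻‖ ≤ ‖x‖ := by
  rw [← posPart_neg, ← norm_neg x]
  exact norm_posPart_le (-x)

/-- A monotone positively homogeneous function on the cone of a Banach lattice is bounded. -/
theorem exists_bound_of_monotone_of_homogeneous [CompleteSpace E] (p : E → ℝ)
    (hmono : ∀ x y, 0 ≤ x → x ≤ y → p x ≤ p y) (hsmul : ∀ (c : ℝ) x, 0 ≤ c → p (c • x) = c * p x) :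
    ∃ C, 0 ≤ C ∧ ∀ x, 0 ≤ x → p x ≤ C * ‖x‖ := by
  by_contra! H
  have h0 : p 0 = 0 := by simpa using hsmul 0 0 le_rfl
  have key : ∀ n : ℕ, ∃ x : E, 0 ≤ x ∧ ‖x‖ ≤ (1 / 2) ^ n ∧ (n : ℝ) ≤ p x := by
    intro n
    -- The factor `2 ^ n` survives rescaling `x` to norm `2⁻ⁿ`: the value is still at least `n`,
    -- while the rescaled vectors are summable and their sum dominates each of them.
    obtain ⟨x, hx, hpx⟩ := H (n * 2 ^ n) (by positivity)
    have hx0 : 0 < ‖x‖ := by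
      refine norm_pos_iff.2 ?_
      rintro rfl
      simp [h0] at hpx
    have hc : 0 ≤ (1 / 2 : ℝ) ^ n * ‖x‖⁻¹ := by positivity
    refine ⟨((1 / 2) ^ n * ‖x‖⁻¹) • x, smul_nonneg hc hx, ?_, ?_⟩
    · rw [norm_smul, Real.norm_of_nonneg hc, mul_assoc, inv_mul_cancel₀ hx0.ne', mul_one]
    · rw [hsmul _ _ hc]
      calc (n : ℝ) = (1 / 2) ^ n * ‖x‖⁻¹ * (n * 2 ^ n * ‖x‖) := by
            have h2 : (1 / 2 : ℝ) ^ n * 2 ^ n = 1 := by rw [← mul_pow]; norm_num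
            have h3 : ‖x‖⁻¹ * ‖x‖ = 1 := inv_mul_cancel₀ hx0.ne'
            linear_combination (-(n : ℝ)) * h2 - n * ((1 / 2 : ℝ) ^ n * 2 ^ n) * h3
        _ ≤ _ := by gcongr
  choose x hx hxn hpx using key
  have hs : Summable x := Summable.of_norm_bounded summable_geometric_two hxn
  obtain ⟨n, hn⟩ := exists_nat_gt (p (∑' n, x n))
  have := hmono (x n) _ (hx n) (hs.le_tsum n fun j _ => hx j)
  linarith [hpx n]

theorem exists_strongDual_eq [CompleteSpace E] (f : E →ₗ[ℝ] ℝ) (hf : ∀ x, 0 ≤ x → 0 ≤ f x) :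
    ∃ g : StrongDual ℝ E, ∀ x, g x = f x := by
  obtain ⟨C, hC, h⟩ := exists_bound_of_monotone_of_homogeneous (fun x => f x)
    (fun x y _ hxy => by simpa using hf (y - x) (sub_nonneg.2 hxy)) (fun c x _ => by simp)
  refine ⟨f.mkContinuous (2 * C) fun x => ?_, fun x => rfl⟩
  rw [← posPart_sub_negPart x, map_sub, posPart_sub_negPart x]
  have h1 := h _ (posPart_nonneg x)
  have h2 := h _ (negPart_nonneg x)
  have h3 := hf _ (posPart_nonneg x)
  have h4 := hf _ (negPart_nonneg x)
  have h5 : C * ‖x⁺‖ ≤ C * ‖x‖ := by gcongr; exact norm_posPart_le x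
  have h6 : C * ‖x⁻‖ ≤ C * ‖x‖ := by gcongr; exact norm_negPart_le x
  rw [Real.norm_eq_abs, abs_le]
  constructor <;> nlinarith [norm_nonneg x]

omit [IsOrderedModule ℝ E] [HasSolidNorm E] in
theorem strongDual_mono {f : StrongDual ℝ E} (hf : 0 ≤ f) {x y : E} (h : x ≤ y) : f x ≤ f y := by
  have := hf (y - x) (sub_nonneg.2 h)
  simpa using this

omit [IsOrderedModule ℝ E] in
theorem abs_strongDual_le {f g : StrongDual ℝ E} (hf : 0 ≤ f) (hfg : f ≤ g) (x : E) :
    |f x| ≤ ‖g‖ * ‖x‖ := by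
  have h1 : |f x| ≤ f |x| := by
    rw [abs_le']
    exact ⟨strongDual_mono hf (le_abs_self x), by
      rw [← map_neg]; exact strongDual_mono hf (neg_le_abs x)⟩
  calc |f x| ≤ f |x| := h1
    _ ≤ g |x| := hfg _ (abs_nonneg x)
    _ ≤ ‖g |x|‖ := le_abs_self _
    _ ≤ ‖g‖ * ‖|x|‖ := g.le_opNorm _
    _ = ‖g‖ * ‖x‖ := by rw [norm_abs_eq_norm]

omit [IsOrderedModule ℝ E] in
theorem norm_strongDual_mono {f g : StrongDual ℝ E} (hf : 0 ≤ f) (hfg : f ≤ g) : ‖f‖ ≤ ‖g‖ :=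
  f.opNorm_le_bound (norm_nonneg g) fun x => abs_strongDual_le hf hfg x

omit [IsOrderedModule ℝ E] in
/-- A positive additive function on the cone, dominated by a bounded functional, extends to a
bounded functional. -/
theorem exists_strongDual_of_additive_on_cone (F : E → ℝ) (φ : StrongDual ℝ E)
    (hadd : ∀ x y, 0 ≤ x → 0 ≤ y → F (x + y) = F x + F y) (hpos : ∀ x, 0 ≤ x → 0 ≤ F x)
    (hle : ∀ x, 0 ≤ x → F x ≤ φ x) : ∃ g : StrongDual ℝ E, ∀ x, 0 ≤ x → g x = F x := by
  have h0 : F 0 = 0 := by simpa using hadd 0 0 le_rfl le_rfl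
  let g : E →+ ℝ := AddMonoidHom.mk' (fun x => F x⁺ - F x⁻) fun x y => by
    have h := congrArg F (posPart_add_add_negPart_add_negPart x y)
    have px := posPart_nonneg x
    have py := posPart_nonneg y
    have nx := negPart_nonneg x
    have ny := negPart_nonneg y
    rw [hadd _ _ (posPart_nonneg _) (add_nonneg nx ny), hadd _ _ nx ny,
      hadd _ _ (negPart_nonneg _) (add_nonneg px py), hadd _ _ px py] at h
    linarith
  have hb : ∀ x, ‖g x‖ ≤ ‖φ‖ * ‖x‖ := by
    intro x
    have h1 := hpos _ (posPart_nonneg x)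
    have h2 := hpos _ (negPart_nonneg x)
    have h3 : F x⁺ + F x⁻ ≤ φ |x| := by
      rw [← hadd _ _ (posPart_nonneg x) (negPart_nonneg x), posPart_add_negPart]
      exact hle _ (abs_nonneg x)
    have h4 : φ |x| ≤ ‖φ‖ * ‖x‖ := by
      rw [← norm_abs_eq_norm x]
      exact (le_abs_self _).trans (φ.le_opNorm _)
    rw [Real.norm_eq_abs, abs_le]
    change _ ≤ F x⁺ - F x⁻ ∧ F x⁺ - F x⁻ ≤ _
    constructor <;> linarith
  -- Homogeneity is not assumed: a continuous additive map is automatically real linear.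
  refine ⟨g.toRealLinearMap (AddMonoidHomClass.continuous_of_bound g _ hb), fun x hx => ?_⟩
  change F x⁺ - F x⁻ = F x
  rw [posPart_of_nonneg hx, negPart_of_nonneg hx, h0, sub_zero]

omit [IsOrderedModule ℝ E] in
/-- The component of a positive functional `φ` on the band generated by `u`. -/
theorem exists_component (φ : StrongDual ℝ E) (hφ : 0 ≤ φ) {u : E} (hu : 0 ≤ u) :
    ∃ g : StrongDual ℝ E, 0 ≤ g ∧
      ∀ x, 0 ≤ x → Tendsto (fun k : ℕ => φ (x ⊓ k • u)) atTop (𝓝 (g x)) := by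
  have hmono : ∀ x : E, Monotone fun k : ℕ => φ (x ⊓ k • u) := fun x k l hkl =>
    strongDual_mono hφ (inf_le_inf le_rfl (nsmul_le_nsmul_left hu hkl))
  have hbdd : ∀ x : E, BddAbove (Set.range fun k : ℕ => φ (x ⊓ k • u)) := fun x => by
    refine ⟨φ x, ?_⟩
    rintro _ ⟨k, rfl⟩
    exact strongDual_mono hφ inf_le_left
  have hlim : ∀ x : E, Tendsto (fun k : ℕ => φ (x ⊓ k • u)) atTop
      (𝓝 (⨆ k : ℕ, φ (x ⊓ k • u))) := fun x => tendsto_atTop_ciSup (hmono x) (hbdd x)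
  have hpos : ∀ x : E, 0 ≤ x → 0 ≤ ⨆ k : ℕ, φ (x ⊓ k • u) := fun x hx =>
    ge_of_tendsto' (hlim x) fun k => hφ _ (le_inf hx (nsmul_nonneg hu k))
  have hadd : ∀ x y : E, 0 ≤ x → 0 ≤ y → ⨆ k : ℕ, φ ((x + y) ⊓ k • u) =
      (⨆ k : ℕ, φ (x ⊓ k • u)) + ⨆ k : ℕ, φ (y ⊓ k • u) := by
    intro x y hx hy
    refine le_antisymm (le_of_tendsto_of_tendsto' (hlim (x + y)) ((hlim x).add (hlim y))
      fun k => ?_) (le_of_tendsto' ((hlim x).add (hlim y)) fun k => ?_)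
    · rw [← map_add]
      refine strongDual_mono hφ ?_
      have := inf_add_le_inf_add_inf (nsmul_nonneg hu k) hx hy
      rwa [inf_comm, inf_comm (k • u) x, inf_comm (k • u) y] at this
    -- Superadditivity costs a doubling of the index: `x ⊓ ku + y ⊓ ku ≤ (x + y) ⊓ 2ku`.
    · refine le_trans ?_ (le_ciSup (hbdd (x + y)) (k + k))
      rw [← map_add]
      refine strongDual_mono hφ (le_inf (add_le_add inf_le_left inf_le_left) ?_)
      rw [add_nsmul]
      exact add_le_add inf_le_right inf_le_right
  obtain ⟨g, hg⟩ := exists_strongDual_of_additive_on_cone (fun x => ⨆ k : ℕ, φ (x ⊓ k • u)) φ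
    hadd hpos fun x _ => ciSup_le fun k => strongDual_mono hφ inf_le_left
  exact ⟨g, fun x hx => by simpa [hg x hx] using hpos x hx, fun x hx => by
    rw [hg x hx]; exact hlim x⟩

end PositiveFunctionals

/-! ### Coordinates and norm in `ℓ₁`. -/

section EllOne

theorem ellOne_summable (a : lp (fun _ : ℕ => ℝ) 1) : Summable fun n => |a n| := by
  have := (memℓp_gen_iff (by norm_num)).1 (lp.memℓp a)
  simpa using this

theorem ellOne_norm_eq (a : lp (fun _ : ℕ => ℝ) 1) : ‖a‖ = ∑' n, |a n| := by
  rw [lp.norm_eq_tsum_rpow (by norm_num)]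
  simp

theorem exists_ellOne (b : ℕ → ℝ) (hb : Summable fun n => |b n|) :
    ∃ a : lp (fun _ : ℕ => ℝ) 1, ∀ n, a n = b n :=
  ⟨⟨b, (memℓp_gen_iff (by norm_num)).2 (by simpa using hb)⟩, fun _ => rfl⟩

end EllOne

/-! ### From disjoint sequences to `ℓ₁`, and approximate order bounds. -/

section DisjointSequences

variable {E : Type*} [NormedAddCommGroup E] [NormedSpace ℝ E] [CompleteSpace E] [Lattice E]
  [IsOrderedAddMonoid E] [IsOrderedModule ℝ E] [HasSolidNorm E]

omit [Lattice E] [IsOrderedAddMonoid E] [IsOrderedModule ℝ E] [HasSolidNorm E] in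
theorem summable_smul_of_norm_le {y : ℕ → E} {M : ℝ} (hM : ∀ n, ‖y n‖ ≤ M) {a : ℕ → ℝ}
    (ha : Summable fun n => |a n|) : Summable fun n => a n • y n := by
  refine Summable.of_norm_bounded (ha.mul_right M) fun n => ?_
  rw [norm_smul, Real.norm_eq_abs]
  exact mul_le_mul_of_nonneg_left (hM n) (abs_nonneg _)

theorem summable_abs_posPart {a : ℕ → ℝ} (ha : Summable fun n => |a n|) :
    Summable fun n => |(a n)⁺| := by
  refine Summable.of_nonneg_of_le (fun n => abs_nonneg _) (fun n => ?_) ha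
  rw [abs_of_nonneg (posPart_nonneg _), ← posPart_add_negPart (a n)]
  exact le_add_of_nonneg_right (negPart_nonneg _)

theorem summable_abs_negPart {a : ℕ → ℝ} (ha : Summable fun n => |a n|) :
    Summable fun n => |(a n)⁻| := by
  refine Summable.of_nonneg_of_le (fun n => abs_nonneg _) (fun n => ?_) ha
  rw [abs_of_nonneg (negPart_nonneg _), ← posPart_add_negPart (a n)]
  exact le_add_of_nonneg_left (posPart_nonneg _)

/-- Partial sums are disjoint, and `⊓` is norm continuous. -/
theorem tsum_smul_inf_tsum_smul_eq_zero {y : ℕ → E} (hy : ∀ n, 0 ≤ y n)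
    (hd : ∀ n m, n ≠ m → y n ⊓ y m = 0) {M : ℝ} (hM : ∀ n, ‖y n‖ ≤ M) {a b : ℕ → ℝ}
    (ha : Summable fun n => |a n|) (hb : Summable fun n => |b n|) (ha0 : ∀ n, 0 ≤ a n)
    (hb0 : ∀ n, 0 ≤ b n) (hab : ∀ n, a n = 0 ∨ b n = 0) :
    (∑' n, a n • y n) ⊓ (∑' n, b n • y n) = 0 := by
  have h1 := (summable_smul_of_norm_le hM ha).hasSum
  have h2 := (summable_smul_of_norm_le hM hb).hasSum
  refine tendsto_nhds_unique (h1.inf_nhds h2) (tendsto_const_nhds.congr fun s => ?_)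
  have hay : ∀ n, 0 ≤ a n • y n := fun n => smul_nonneg (ha0 n) (hy n)
  have hby : ∀ n, 0 ≤ b n • y n := fun n => smul_nonneg (hb0 n) (hy n)
  refine (inf_sum_eq_zero (Finset.sum_nonneg fun n _ => hay n) s _ (fun n _ => hby n)
    fun n _ => ?_).symm
  rw [inf_comm]
  refine inf_sum_eq_zero (hby n) s _ (fun n _ => hay n) fun m _ => ?_
  by_cases hnm : n = m
  · subst hnm
    rcases hab n with h | h
    · rw [h, zero_smul]; exact inf_of_le_right (hby n)
    · rw [h, zero_smul]; exact inf_of_le_left (hay n)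
  · exact smul_inf_smul_eq_zero (hy n) (hy m) (hd n m hnm) (hb0 n) (ha0 m)

/-- The series splits as a difference of two disjoint positive series, and such a splitting
determines the positive part. Hence lattice operations on the span are coordinatewise. -/
theorem posPart_tsum_smul {y : ℕ → E} (hy : ∀ n, 0 ≤ y n)
    (hd : ∀ n m, n ≠ m → y n ⊓ y m = 0) {M : ℝ} (hM : ∀ n, ‖y n‖ ≤ M) {a : ℕ → ℝ}
    (ha : Summable fun n => |a n|) : (∑' n, a n • y n)⁺ = ∑' n, (a n)⁺ • y n := by
  have hp := summable_abs_posPart ha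
  have hn := summable_abs_negPart ha
  have h := tsum_smul_inf_tsum_smul_eq_zero hy hd hM hp hn (fun n => posPart_nonneg _)
    (fun n => negPart_nonneg _) fun n => by
      rcases le_total 0 (a n) with h | h
      · right; exact negPart_of_nonneg h
      · left; exact posPart_of_nonpos h
  rw [← posPart_eq_of_inf_eq_zero h,
    ← (summable_smul_of_norm_le hM hp).tsum_sub (summable_smul_of_norm_le hM hn)]
  simp only [← sub_smul, posPart_sub_negPart]

theorem negPart_tsum_smul {y : ℕ → E} (hy : ∀ n, 0 ≤ y n)
    (hd : ∀ n m, n ≠ m → y n ⊓ y m = 0) {M : ℝ} (hM : ∀ n, ‖y n‖ ≤ M) {a : ℕ → ℝ}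
    (ha : Summable fun n => |a n|) : (∑' n, a n • y n)⁻ = ∑' n, (a n)⁻ • y n := by
  have := posPart_tsum_smul hy hd hM (a := fun n => -a n) (by simpa using ha)
  simpa only [neg_smul, tsum_neg, posPart_neg] using this

/-- A bounded disjoint sequence on which a positive functional is bounded below spans a
sublattice isomorphic to `ℓ₁`. -/
theorem containsEllOneSublattice_of_disjoint {y : ℕ → E} (hy : ∀ n, 0 ≤ y n)
    (hd : ∀ n m, n ≠ m → y n ⊓ y m = 0) {M : ℝ} (hM : ∀ n, ‖y n‖ ≤ M) {f : StrongDual ℝ E}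
    {δ : ℝ} (hδ : 0 < δ) (hf : ∀ n, δ ≤ f (y n)) : ContainsEllOneSublattice E := by
  have hM0 : 0 ≤ M := (norm_nonneg _).trans (hM 0)
  have hsum : ∀ a : lp (fun _ : ℕ => ℝ) 1, Summable fun n => a n • y n := fun a =>
    summable_smul_of_norm_le hM (ellOne_summable a)
  let Φ : lp (fun _ : ℕ => ℝ) 1 →ₗ[ℝ] E :=
    { toFun := fun a => ∑' n, a n • y n
      map_add' := fun a b => by
        rw [← (hsum a).tsum_add (hsum b)]
        simp [add_smul]
      map_smul' := fun c a => by
        rw [RingHom.id_apply, ← (hsum a).tsum_const_smul c]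
        simp [smul_smul] }
  have hΦ : ∀ a, Φ a = ∑' n, a n • y n := fun a => rfl
  have hfS : ∀ c : ℕ → ℝ, Summable (fun n => |c n|) →
      HasSum (fun n => c n * f (y n)) (f (∑' n, c n • y n)) := fun c hc => by
    simpa using f.hasSum (summable_smul_of_norm_le hM hc).hasSum
  -- Applying `f` to `|Φ a| = ∑ |a n| • y n` recovers the `ℓ₁`-norm up to the factor `δ`.
  have hlow : ∀ a, δ * ‖a‖ ≤ ‖f‖ * ‖Φ a‖ := by
    intro a
    have ha := ellOne_summable a
    have h1 : ∑' n, |a n| • y n = |Φ a| := by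
      rw [← posPart_add_negPart (Φ a), hΦ, posPart_tsum_smul hy hd hM ha,
        negPart_tsum_smul hy hd hM ha,
        ← (summable_smul_of_norm_le hM (summable_abs_posPart ha)).tsum_add
          (summable_smul_of_norm_le hM (summable_abs_negPart ha))]
      simp only [← add_smul, posPart_add_negPart]
    have h2 := hfS (fun n => |a n|) (by simpa using ha)
    rw [h1] at h2
    calc δ * ‖a‖ ≤ f |Φ a| := by
          rw [ellOne_norm_eq, mul_comm]
          exact hasSum_le (fun n => mul_le_mul_of_nonneg_left (hf n) (abs_nonneg _))
            (ha.hasSum.mul_right δ) h2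
      _ ≤ ‖f‖ * ‖|Φ a|‖ := (le_abs_self _).trans (f.le_opNorm _)
      _ = ‖f‖ * ‖Φ a‖ := by rw [norm_abs_eq_norm]
  have hup : ∀ a, ‖Φ a‖ ≤ M * ‖a‖ := by
    intro a
    rw [ellOne_norm_eq, mul_comm]
    refine tsum_of_norm_bounded ((ellOne_summable a).hasSum.mul_right M) fun n => ?_
    rw [norm_smul, Real.norm_eq_abs]
    exact mul_le_mul_of_nonneg_left (hM n) (abs_nonneg _)
  have hlow' : ∀ a, ‖a‖ ≤ (‖f‖ / δ) * ‖Φ a‖ := fun a => by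
    rw [div_mul_eq_mul_div, le_div_iff₀ hδ, mul_comm]
    exact hlow a
  have hinj : Function.Injective Φ := by
    rw [injective_iff_map_eq_zero]
    intro a ha
    have := hlow' a
    rw [ha, norm_zero, mul_zero] at this
    exact norm_le_zero_iff.1 this
  have hnonneg : ∀ a, 0 ≤ Φ a ↔ ∀ n, 0 ≤ a n := by
    intro a
    have ha := ellOne_summable a
    refine ⟨fun h n => ?_, fun h => tsum_nonneg fun n => smul_nonneg (h n) (hy n)⟩
    have h1 : ∑' n, (a n)⁻ • y n = 0 := by
      rw [← negPart_tsum_smul hy hd hM ha, ← hΦ]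
      exact negPart_of_nonneg h
    have h2 := hfS _ (summable_abs_negPart ha)
    have hfy : ∀ n, 0 ≤ (a n)⁻ * f (y n) := fun n =>
      mul_nonneg (negPart_nonneg _) (hδ.le.trans (hf n))
    rw [h1, map_zero] at h2
    have h3 := (hasSum_zero_iff_of_nonneg hfy).1 h2
    have h4 := congrFun h3 n
    simp only [Pi.zero_apply, mul_eq_zero] at h4
    rcases h4 with h4 | h4
    · exact negPart_eq_zero.1 h4
    · linarith [hf n]
  have hpos : ∀ a, (Φ a)⁺ ∈ LinearMap.range Φ := by
    intro a
    have ha := ellOne_summable a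
    obtain ⟨b, hb⟩ := exists_ellOne _ (summable_abs_posPart ha)
    refine ⟨b, ?_⟩
    rw [hΦ, hΦ, posPart_tsum_smul hy hd hM ha]
    simp only [hb]
  let e := (LinearEquiv.ofInjective Φ hinj).toContinuousLinearEquivOfBounds M (‖f‖ / δ)
    (fun a => hup a) (fun x => by
      obtain ⟨a, rfl⟩ := (LinearEquiv.ofInjective Φ hinj).surjective x
      rw [LinearEquiv.symm_apply_apply]
      exact hlow' a)
  have he : ∀ a, (e a : E) = Φ a := fun a => rfl
  refine ⟨LinearMap.range Φ, ?_, e, fun a b => ?_⟩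
  · rintro _ ⟨a, rfl⟩ _ ⟨b, rfl⟩
    have h := hpos (a - b)
    rw [map_sub] at h
    constructor
    · rw [sup_eq_add_posPart_sub]
      exact add_mem ⟨b, rfl⟩ h
    · rw [inf_eq_sub_posPart_sub]
      exact sub_mem ⟨a, rfl⟩ h
  · rw [he, he, ← sub_nonneg, ← map_sub, hnonneg]
    simp

omit [IsOrderedModule ℝ E] [CompleteSpace E] [HasSolidNorm E] in
theorem strongDual_posPart_sub_le {f : StrongDual ℝ E} (hf : 0 ≤ f) {a b : E} (hb : 0 ≤ b) :
    f a⁺ - f b ≤ f (a - b)⁺ := by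
  rw [sub_le_iff_le_add, ← map_add]
  refine strongDual_mono hf (sup_le ?_ (add_nonneg (posPart_nonneg _) hb))
  rw [← sub_le_iff_le_add]
  exact le_posPart _

/-- If `E` contains no sublattice isomorphic to `ℓ₁`, then the balls of `E` are approximately
order bounded with respect to every positive functional. -/
theorem exists_approx_order_bound (hE : ¬ ContainsEllOneSublattice E) {f : StrongDual ℝ E}
    (hf : 0 ≤ f) {ε : ℝ} (hε : 0 < ε) (M : ℝ) :
    ∃ u : E, 0 ≤ u ∧ ∀ x, 0 ≤ x → ‖x‖ ≤ M → f (x - u)⁺ ≤ ε := by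
  by_contra! H
  apply hE
  choose! X hX0 hXM hX using H
  -- `s n` is the sum of the vectors chosen so far; the next one is a counterexample to the bound `u
  -- = 4ⁿ • s n`.
  let s : ℕ → E := fun n => Nat.rec 0 (fun n t => t + X ((4 : ℝ) ^ n • t)) n
  let x : ℕ → E := fun n => X ((4 : ℝ) ^ n • s n)
  have hs : ∀ n, s (n + 1) = s n + x n := fun n => rfl
  have hs0 : ∀ n, 0 ≤ s n := by
    intro n
    induction n with
    | zero => exact le_rfl
    | succ n ih => exact add_nonneg ih (hX0 _ (smul_nonneg (by positivity) ih))
  have hs4 : ∀ n, 0 ≤ (4 : ℝ) ^ n • s n := fun n => smul_nonneg (by positivity) (hs0 n)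
  have hx0 : ∀ n, 0 ≤ x n := fun n => hX0 _ (hs4 n)
  have hxM : ∀ n, ‖x n‖ ≤ M := fun n => hXM _ (hs4 n)
  have hxf : ∀ n, ε < f (x n - (4 : ℝ) ^ n • s n)⁺ := fun n => hX _ (hs4 n)
  have hsmono : Monotone s := monotone_nat_of_le_succ fun n => by
    rw [hs]; exact le_add_of_nonneg_right (hx0 n)
  have hxs : ∀ n m, n < m → x n ≤ s m := fun n m hnm =>
    (by rw [hs]; exact le_add_of_nonneg_left (hs0 n) : x n ≤ s (n + 1)).trans (hsmono hnm)
  have hsum : Summable fun n => ((1 / 2 : ℝ) ^ n) • x n :=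
    summable_smul_of_norm_le hxM (by simpa [abs_of_nonneg] using summable_geometric_two)
  set z : E := ∑' n, ((1 / 2 : ℝ) ^ n) • x n with hz
  have hzx : ∀ n, ((1 / 2 : ℝ) ^ n) • x n ≤ z := fun n =>
    hsum.le_tsum n fun j _ => smul_nonneg (by positivity) (hx0 j)
  have hz0 : 0 ≤ z := tsum_nonneg fun n => smul_nonneg (by positivity) (hx0 n)
  -- Subtracting `4ⁿ • s n` separates `v n` from earlier terms, and subtracting `2⁻ⁿ • z` from later
  -- ones, since `2⁻ⁿ • z ≥ 2⁻ⁿ 2⁻ᵐ • x m ≥ 4⁻ᵐ • x m` for `n < m`. The second subtraction costs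
  -- only `2⁻ⁿ * f z`, which is below `ε / 2` from some index `N` on.
  let v : ℕ → E := fun n => (x n - (4 : ℝ) ^ n • s n - ((1 / 2 : ℝ) ^ n) • z)⁺
  have hv0 : ∀ n, 0 ≤ v n := fun n => posPart_nonneg _
  have hvx : ∀ n, v n ≤ x n := fun n => sup_le (by
    rw [sub_sub]
    exact sub_le_self _ (add_nonneg (hs4 n) (smul_nonneg (by positivity) hz0))) (hx0 n)
  have hvM : ∀ n, ‖v n‖ ≤ M := fun n =>
    (norm_le_norm_of_nonneg_of_le (hv0 n) (hvx n)).trans (hxM n)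
  have hdlt : ∀ n m, n < m → v n ⊓ v m = 0 := by
    intro n m hnm
    have h4 : (0 : ℝ) < 4 ^ m := by positivity
    have h1 : v m ≤ (x m - (4 : ℝ) ^ m • x n)⁺ := by
      refine posPart_mono ?_
      rw [sub_sub]
      refine sub_le_sub_left (le_add_of_le_of_nonneg ?_ (smul_nonneg (by positivity) hz0)) _
      exact smul_le_smul_of_nonneg_left (hxs n m hnm) h4.le
    have h2 : v n ≤ ((4 : ℝ) ^ m)⁻¹ • ((4 : ℝ) ^ m • x n - x m)⁺ := by
      refine sup_le ?_ (smul_nonneg (by positivity) (posPart_nonneg _))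
      calc x n - (4 : ℝ) ^ n • s n - ((1 / 2 : ℝ) ^ n) • z
          ≤ x n - ((4 : ℝ) ^ m)⁻¹ • x m := by
            rw [sub_sub]
            refine sub_le_sub_left (le_add_of_nonneg_of_le (hs4 n) ?_) _
            calc ((4 : ℝ) ^ m)⁻¹ • x m ≤ ((1 / 2 : ℝ) ^ n) • ((1 / 2 : ℝ) ^ m) • x m := by
                  rw [smul_smul]
                  refine smul_le_smul_of_nonneg_right ?_ (hx0 m)
                  have h5 : ((4 : ℝ) ^ m)⁻¹ = (1 / 2) ^ m * (1 / 2) ^ m := by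
                    rw [← mul_pow, ← inv_pow]; norm_num
                  rw [h5]
                  exact mul_le_mul_of_nonneg_right
                    (pow_le_pow_of_le_one (by norm_num) (by norm_num) hnm.le) (by positivity)
              _ ≤ _ := smul_le_smul_of_nonneg_left (hzx m) (by positivity)
        _ = ((4 : ℝ) ^ m)⁻¹ • ((4 : ℝ) ^ m • x n - x m) := by
            rw [smul_sub, smul_smul, inv_mul_cancel₀ h4.ne', one_smul]
        _ ≤ _ := smul_le_smul_of_nonneg_left (le_posPart _) (by positivity)
    have h3 : ((4 : ℝ) ^ m • x n - x m)⁺ ⊓ (x m - (4 : ℝ) ^ m • x n)⁺ = 0 := by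
      rw [← neg_sub ((4 : ℝ) ^ m • x n) (x m), posPart_neg]
      exact posPart_inf_negPart_eq_zero _
    refine le_antisymm ((inf_le_inf h2 h1).trans ?_) (le_inf (hv0 n) (hv0 m))
    have h4 := smul_inf_smul_eq_zero (posPart_nonneg _) (posPart_nonneg _) h3
      (a := ((4 : ℝ) ^ m)⁻¹) (b := 1) (by positivity) zero_le_one
    rw [one_smul] at h4
    exact h4.le
  have hlim : Tendsto (fun n : ℕ => (1 / 2 : ℝ) ^ n * f z) atTop (𝓝 0) := by
    simpa using (tendsto_pow_atTop_nhds_zero_of_lt_one (r := (1 / 2 : ℝ)) (by norm_num)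
      (by norm_num)).mul_const (f z)
  obtain ⟨N, hN⟩ := ((hlim.eventually (gt_mem_nhds (half_pos hε)))).exists_forall_of_atTop
  refine containsEllOneSublattice_of_disjoint (y := fun n => v (n + N)) (fun n => hv0 _)
    (fun n m hnm => ?_) (fun n => hvM _) (half_pos hε) (f := f) fun n => ?_
  · rcases lt_or_gt_of_ne hnm with h | h
    · exact hdlt _ _ (by omega)
    · rw [inf_comm]; exact hdlt _ _ (by omega)
  · have h1 := strongDual_posPart_sub_le hf (a := x (n + N) - (4 : ℝ) ^ (n + N) • s (n + N))
      (b := ((1 / 2 : ℝ) ^ (n + N)) • z) (smul_nonneg (by positivity) hz0)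
    have h2 := hN (n + N) (by omega)
    have h3 := hxf (n + N)
    rw [map_smul, smul_eq_mul] at h1
    change ε / 2 ≤ f (x (n + N) - (4 : ℝ) ^ (n + N) • s (n + N) - ((1 / 2 : ℝ) ^ (n + N)) • z)⁺
    linarith

end DisjointSequences

/-! ### Biorthogonal functionals for an `ℓ₁`-sublattice. -/

section EllOneSublattice

variable {E : Type*} [NormedAddCommGroup E] [NormedSpace ℝ E] [Lattice E]
  [IsOrderedAddMonoid E] [IsOrderedModule ℝ E] [HasSolidNorm E]

omit [HasSolidNorm E] [IsOrderedAddMonoid E] in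
theorem posPart_smul_of_pos {c : ℝ} (hc : 0 < c) (x : E) : (c • x)⁺ = c • x⁺ := by
  have key : ∀ {c : ℝ} (x : E), 0 < c → (c • x)⁺ ≤ c • x⁺ := fun {c} x hc =>
    sup_le (smul_le_smul_of_nonneg_left (le_posPart x) hc.le)
      (smul_nonneg hc.le (posPart_nonneg x))
  refine le_antisymm (key x hc) ?_
  have h := smul_le_smul_of_nonneg_left (key (c • x) (inv_pos.2 hc)) hc.le
  rwa [smul_smul, smul_smul, inv_mul_cancel₀ hc.ne', mul_inv_cancel₀ hc.ne', one_smul,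
    one_smul] at h

/-- A functional on a subspace dominated by a multiple of the norm of the positive part extends to
a positive functional. -/
theorem exists_positive_extension (F : Submodule ℝ E) (S : F →ₗ[ℝ] ℝ) {C : ℝ} (hC : 0 ≤ C)
    (hS : ∀ x : F, S x ≤ C * ‖(x : E)⁺‖) :
    ∃ φ : StrongDual ℝ E, 0 ≤ φ ∧ ∀ x : F, φ x = S x := by
  -- Dominating by `C * ‖x⁺‖` rather than `C * ‖x‖` forces positivity: for `x ≥ 0` the bound at `-x`
  -- is `0`.
  obtain ⟨g, hg, hgN⟩ := exists_extension_of_le_sublinear ⟨F, S⟩ (fun x => C * ‖x⁺‖)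
    (fun c hc x => by rw [posPart_smul_of_pos hc, norm_smul, Real.norm_of_nonneg hc.le]; ring)
    (fun x y => by
      rw [← mul_add]
      refine mul_le_mul_of_nonneg_left (le_trans ?_ (norm_add_le _ _)) hC
      refine norm_le_norm_of_nonneg_of_le (posPart_nonneg _) (sup_le ?_ ?_)
      · exact add_le_add (le_posPart x) (le_posPart y)
      · exact add_nonneg (posPart_nonneg x) (posPart_nonneg y)) hS
  have hbound : ∀ x, g x ≤ C * ‖x‖ := fun x =>
    (hgN x).trans (mul_le_mul_of_nonneg_left (norm_posPart_le x) hC)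
  refine ⟨g.mkContinuous C fun x => ?_, fun x hx => ?_, hg⟩
  · rw [Real.norm_eq_abs, abs_le']
    refine ⟨hbound x, ?_⟩
    simpa using hbound (-x)
  · have h := hgN (-x)
    have h0 : (-x)⁺ = 0 := posPart_eq_zero.2 (neg_nonpos.2 hx)
    simp only [map_neg, h0, norm_zero, mul_zero] at h
    change (0 : ℝ) ≤ g x
    linarith

/-- A sublattice isomorphic to `ℓ₁` has a biorthogonal system of positive functionals with
bounded sum. -/
theorem exists_biorthogonal_of_containsEllOneSublattice (hE : ContainsEllOneSublattice E) :
    ∃ (x : ℕ → E) (M : ℝ) (ψ : ℕ → StrongDual ℝ E) (φ : StrongDual ℝ E),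
      (∀ n, 0 ≤ x n) ∧ (∀ n, ‖x n‖ ≤ M) ∧ (∀ n, 0 ≤ ψ n) ∧
      (∀ n m, ψ n (x m) = if n = m then 1 else 0) ∧
      ∀ (s : Finset ℕ) (y : E), 0 ≤ y → ∑ n ∈ s, ψ n y ≤ φ y := by
  obtain ⟨F, hF, e, he⟩ := hE
  have hb : ∀ n : ℕ, ∃ a : lp (fun _ : ℕ => ℝ) 1, ∀ k, a k = if k = n then 1 else 0 := fun n =>
    exists_ellOne _ (summable_of_ne_finset_zero (s := {n}) fun k hk => by
      simp [Finset.notMem_singleton.1 hk])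
  choose b hb using hb
  have hb_norm : ∀ n, ‖b n‖ = 1 := fun n => by
    rw [ellOne_norm_eq, tsum_eq_single n (fun k hk => by simp [hb, hk])]
    simp [hb]
  let S : lp (fun _ : ℕ => ℝ) 1 →ₗ[ℝ] ℝ :=
    { toFun := fun a => ∑' n, a n
      map_add' := fun a c => by
        rw [← (ellOne_summable a).of_abs.tsum_add (ellOne_summable c).of_abs]
        simp
      map_smul' := fun r a => by
        rw [RingHom.id_apply, ← (ellOne_summable a).of_abs.tsum_const_smul r]
        simp }
  have hSb : ∀ n, S (b n) = 1 := fun n => by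
    change ∑' k, b n k = 1
    rw [tsum_eq_single n (fun k hk => by simp [hb, hk])]
    simp [hb]
  have hnonneg : ∀ a, (∀ n, 0 ≤ a n) ↔ 0 ≤ (e a : E) := fun a => by
    have := he 0 a
    simpa using this
  let C := ‖(e.symm : F →L[ℝ] lp (fun _ : ℕ => ℝ) 1)‖
  have hdom : ∀ y : F, S (e.symm y) ≤ C * ‖(y : E)⁺‖ := by
    intro y
    -- The positive part stays in the sublattice, so it has coordinates `c`; they are nonnegative
    -- and their sum is exactly the `ℓ₁`-norm.
    obtain ⟨c, hc⟩ : ∃ c, (e c : E) = (y : E)⁺ :=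
      ⟨e.symm ⟨(y : E)⁺, (hF y y.2 0 F.zero_mem).1⟩, by simp⟩
    have hle : ∀ n, e.symm y n ≤ c n := (he _ _).2 (by simpa [hc] using le_posPart (y : E))
    have hc0 : ∀ n, 0 ≤ c n := (hnonneg c).2 (by rw [hc]; exact posPart_nonneg _)
    calc S (e.symm y) ≤ S c :=
          (ellOne_summable _).of_abs.tsum_le_tsum hle (ellOne_summable _).of_abs
      _ = ‖c‖ := by
          rw [ellOne_norm_eq]
          exact tsum_congr fun n => (abs_of_nonneg (hc0 n)).symm
      _ = ‖(e.symm : F →L[ℝ] lp (fun _ : ℕ => ℝ) 1) (e c)‖ := by simp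
      _ ≤ C * ‖e c‖ := ContinuousLinearMap.le_opNorm _ _
      _ = C * ‖(y : E)⁺‖ := by rw [← hc]; rfl
  obtain ⟨φ, hφ, hφS⟩ := exists_positive_extension F (S ∘ₗ e.symm.toLinearMap) (norm_nonneg _) hdom
  let x : ℕ → E := fun n => e (b n)
  have hx0 : ∀ n, 0 ≤ x n := fun n => (hnonneg _).1 fun k => by rw [hb]; split_ifs <;> norm_num
  have hxd : ∀ n m, n ≠ m → x n ⊓ x m = 0 := by
    intro n m hnm
    refine le_antisymm ?_ (le_inf (hx0 n) (hx0 m))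
    obtain ⟨c, hc⟩ : ∃ c, (e c : E) = x n ⊓ x m :=
      ⟨e.symm ⟨x n ⊓ x m, (hF _ (e (b n)).2 _ (e (b m)).2).2⟩, by simp⟩
    have h1 := (he c (b n)).2 (by rw [hc]; exact inf_le_left)
    have h2 := (he c (b m)).2 (by rw [hc]; exact inf_le_right)
    have h3 := (he c 0).1 fun k => by
      by_cases hk : k = n
      · simpa [hb, show k ≠ m from fun h => hnm (hk.symm.trans h)] using h2 k
      · simpa [hb, hk] using h1 k
    rw [← hc]
    simpa using h3
  have hφx : ∀ n, φ (x n) = 1 := fun n => by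
    rw [hφS]
    simpa using hSb n
  -- The extension `φ` equals `1` at every `x n`; its components on the bands of the disjoint `x n`
  -- are biorthogonal.
  choose ψ hψ0 hψ using fun n => exists_component φ hφ (hx0 n)
  refine ⟨x, ‖(e : lp (fun _ : ℕ => ℝ) 1 →L[ℝ] F)‖, ψ, φ, hx0, fun n => ?_, hψ0, fun n m => ?_,
    fun s y hy => ?_⟩
  · have := (e : lp (fun _ : ℕ => ℝ) 1 →L[ℝ] F).le_opNorm (b n)
    rw [hb_norm, mul_one] at this
    exact this
  · refine tendsto_nhds_unique (hψ n (x m) (hx0 m)) (tendsto_const_nhds.congr' ?_)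
    filter_upwards [eventually_ge_atTop 1] with k hk
    by_cases hnm : n = m
    · subst hnm
      have : x n ≤ k • x n := by simpa using nsmul_le_nsmul_left (hx0 n) hk
      rw [inf_of_le_left this, hφx, if_pos rfl]
    · have := smul_inf_smul_eq_zero (hx0 m) (hx0 n) (hxd m n (Ne.symm hnm)) zero_le_one
        (Nat.cast_nonneg (α := ℝ) k)
      rw [one_smul, Nat.cast_smul_eq_nsmul] at this
      rw [this, map_zero, if_neg hnm]
  · refine le_of_tendsto' (tendsto_finsetSum s fun n _ => hψ n y hy) fun k => ?_
    rw [← map_sum]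
    refine strongDual_mono hφ (sum_le_of_disjoint hy s _
      (fun n _ => le_inf hy (nsmul_nonneg (hx0 n) k)) (fun n _ m _ hnm => ?_)
      fun n _ => inf_le_left)
    have := smul_inf_smul_eq_zero (hx0 n) (hx0 m) (hxd n m hnm)
      (Nat.cast_nonneg (α := ℝ) k) (Nat.cast_nonneg (α := ℝ) k)
    rw [Nat.cast_smul_eq_nsmul, Nat.cast_smul_eq_nsmul] at this
    exact le_antisymm ((inf_le_inf inf_le_right inf_le_right).trans this.le)
      (le_inf (le_inf hy (nsmul_nonneg (hx0 n) k)) (le_inf hy (nsmul_nonneg (hx0 m) k)))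

end EllOneSublattice

/-! ### Weak* limits, Arens regularity and weak compactness. -/

section Bidual

variable {X : Type*} [NormedAddCommGroup X] [NormedSpace ℝ X]

/-- Bounded nets converge weak* in the bidual along ultrafilters. -/
theorem exists_bidual_limit {ι : Type*} (U : Ultrafilter ι) (x : ι → X) {M : ℝ}
    (hx : ∀ᶠ i in (U : Filter ι), ‖x i‖ ≤ M) :
    ∃ z : StrongDual ℝ (StrongDual ℝ X), ∀ f : StrongDual ℝ X,
      Tendsto (fun i => f (x i)) U (𝓝 (z f)) := by
  let j : ι → WeakDual ℝ (StrongDual ℝ X) := fun i =>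
    StrongDual.toWeakDual (NormedSpace.inclusionInDoubleDual ℝ X (x i))
  have hj : ∀ᶠ i in (U : Filter ι), j i ∈ WeakDual.toStrongDual ⁻¹'
      Metric.closedBall (0 : StrongDual ℝ (StrongDual ℝ X)) M := by
    filter_upwards [hx] with i hi
    change NormedSpace.inclusionInDoubleDual ℝ X (x i) ∈ Metric.closedBall _ _
    rw [mem_closedBall_zero_iff]
    exact (NormedSpace.double_dual_bound ℝ X (x i)).trans hi
  obtain ⟨z, -, hz⟩ := (WeakDual.isCompact_closedBall (𝕜 := ℝ)
    (0 : StrongDual ℝ (StrongDual ℝ X)) M).ultrafilter_le_nhds (U.map j)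
      (le_principal_iff.2 hj)
  refine ⟨WeakDual.toStrongDual z, fun f => ?_⟩
  exact ((WeakDual.eval_continuous f).tendsto z).comp hz

/-- A functional on `ℝ` is multiplication by a scalar, so the two extensions agree once they agree
at the identity. There the condition says that the iterated weak* limits of `B` do not depend on
their order. -/
theorem isArensRegular_of_eq {A : X →ₗ[ℝ] X →ₗ[ℝ] ℝ} {B : X →L[ℝ] X →L[ℝ] ℝ}
    (hB : ∀ x y, B x y = A x y)
    (h : ∀ z w : StrongDual ℝ (StrongDual ℝ X), z (w ∘L B) = w (z ∘L B.flip)) :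
    IsArensRegular A := by
  refine ⟨B, hB, ?_⟩
  ext z w k
  have hk : ∀ r : ℝ, k r = k 1 * r := fun r => by
    have := k.map_smul r 1
    rw [smul_eq_mul, smul_eq_mul, mul_one] at this
    rw [this, mul_comm]
  have h1 : (arensExtension B.flip).flip z w k = w (z ∘L (k 1 • B.flip)) := by
    change w _ = w _
    congr 1
    ext y
    change z _ = z _
    congr 1
    ext x
    exact hk _
  have h2 : arensExtension B z w k = z (w ∘L (k 1 • B)) := by
    change z _ = z _
    congr 1
    ext x
    change w _ = w _
    congr 1
    ext y
    exact hk _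
  rw [h1, h2, ContinuousLinearMap.comp_smul, ContinuousLinearMap.comp_smul, map_smul, map_smul, h]

theorem IsArensRegular.exists_eq {A : X →ₗ[ℝ] X →ₗ[ℝ] ℝ} (hA : IsArensRegular A) :
    ∃ B : X →L[ℝ] X →L[ℝ] ℝ, (∀ x y, B x y = A x y) ∧
      ∀ z w : StrongDual ℝ (StrongDual ℝ X), z (w ∘L B) = w (z ∘L B.flip) := by
  obtain ⟨B, hB, h⟩ := hA
  refine ⟨B, hB, fun z w => ?_⟩
  exact (congrArg (fun R => R z w (ContinuousLinearMap.id ℝ ℝ)) h).symm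

/-- The operator associated with an Arens regular bilinear form is weakly compact. -/
theorem isWeaklyCompactOperator_of_isArensRegular {A : X →ₗ[ℝ] X →ₗ[ℝ] ℝ} (hA : IsArensRegular A)
    (T : X →ₗ[ℝ] StrongDual ℝ X) (hT : ∀ x y, T x y = A x y) : IsWeaklyCompactOperator T := by
  obtain ⟨B, hB, h⟩ := hA.exists_eq
  let S : WeakDual ℝ (StrongDual ℝ X) → WeakSpace ℝ (StrongDual ℝ X) := fun z =>
    toWeakSpace ℝ (StrongDual ℝ X) (WeakDual.toStrongDual z ∘L B.flip)
  have hS : Continuous S := by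
    refine WeakBilin.continuous_of_continuous_eval _ fun w => ?_
    change Continuous fun z : WeakDual ℝ (StrongDual ℝ X) =>
      w (WeakDual.toStrongDual z ∘L B.flip)
    -- Regularity turns each weak evaluation into evaluation of `z` at the fixed functional `w ∘L
    -- B`, which is weak* continuous.
    simp_rw [← h]
    exact WeakDual.eval_continuous _
  refine ((WeakDual.isCompact_closedBall (𝕜 := ℝ)
    (0 : StrongDual ℝ (StrongDual ℝ X)) 1).image hS).closure_of_subset ?_
  rintro _ ⟨_, ⟨x, hx, rfl⟩, rfl⟩
  refine ⟨StrongDual.toWeakDual (NormedSpace.inclusionInDoubleDual ℝ X x), ?_, ?_⟩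
  · change NormedSpace.inclusionInDoubleDual ℝ X x ∈ Metric.closedBall _ _
    rw [mem_closedBall_zero_iff] at hx ⊢
    exact (NormedSpace.double_dual_bound ℝ X x).trans hx
  · change toWeakSpace ℝ (StrongDual ℝ X) _ = toWeakSpace ℝ (StrongDual ℝ X) _
    congr 1
    ext y
    rw [hT, ← hB]
    rfl

theorem IsWeaklyCompactOperator.exists_weak_limit {Y : Type*} [NormedAddCommGroup Y]
    [NormedSpace ℝ Y] {T : X →ₗ[ℝ] Y} (hT : IsWeaklyCompactOperator T) {ι : Type*}
    (U : Ultrafilter ι) (x : ι → X) {M : ℝ} (hx : ∀ i, ‖x i‖ ≤ M) :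
    ∃ g : Y, ∀ w : StrongDual ℝ Y, Tendsto (fun i => w (T (x i))) U (𝓝 (w g)) := by
  set R := max M 1 with hR
  have hR0 : 0 < R := lt_max_of_lt_right one_pos
  have hmem : ∀ i, toWeakSpace ℝ Y (T (R⁻¹ • x i)) ∈
      closure (toWeakSpace ℝ Y '' (T '' Metric.closedBall (0 : X) 1)) := fun i => by
    refine subset_closure ⟨_, ⟨_, ?_, rfl⟩, rfl⟩
    rw [mem_closedBall_zero_iff, norm_smul, norm_inv, Real.norm_of_nonneg hR0.le,
      inv_mul_le_iff₀ hR0, mul_one]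
    exact (hx i).trans (le_max_left _ _)
  obtain ⟨g, -, hg⟩ := IsCompact.ultrafilter_le_nhds hT
    (U.map fun i => toWeakSpace ℝ Y (T (R⁻¹ • x i)))
    (le_principal_iff.2 (Filter.mem_map.2 (Filter.univ_mem' hmem)))
  refine ⟨R • (toWeakSpace ℝ Y).symm g, fun w => ?_⟩
  have h1 : Tendsto (fun i => w (T (R⁻¹ • x i))) U (𝓝 (w ((toWeakSpace ℝ Y).symm g))) :=
    ((WeakBilin.eval_continuous (topDualPairing ℝ Y).flip w).tendsto g).comp hg
  have h2 := h1.const_mul R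
  simpa [smul_smul, hR0.ne'] using h2

end Bidual

/-! ### An `ℓ₁`-sublattice violates each of the other conditions. -/

section NegativeResults

variable {E : Type*} [NormedAddCommGroup E] [NormedSpace ℝ E] [CompleteSpace E] [Lattice E]
  [IsOrderedAddMonoid E] [IsOrderedModule ℝ E] [HasSolidNorm E]

/-- Positive bilinear forms on a Banach lattice are bounded. -/
theorem exists_continuous_bilinear_eq (A : E →ₗ[ℝ] E →ₗ[ℝ] ℝ)
    (hA : ∀ x y : E, 0 ≤ x → 0 ≤ y → 0 ≤ A x y) :
    ∃ B : E →L[ℝ] E →L[ℝ] ℝ, ∀ x y, B x y = A x y := by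
  have key : ∀ x : E, ∃ g : StrongDual ℝ E, ∀ y, g y = A x y := by
    intro x
    obtain ⟨g, hg⟩ := exists_strongDual_eq (A x⁺) fun y => hA _ y (posPart_nonneg x)
    obtain ⟨k, hk⟩ := exists_strongDual_eq (A x⁻) fun y => hA _ y (negPart_nonneg x)
    refine ⟨g - k, fun y => ?_⟩
    rw [_root_.sub_apply, hg, hk, ← LinearMap.sub_apply, ← map_sub,
      posPart_sub_negPart]
  choose g hg using key
  have hg0 : ∀ x, 0 ≤ x → 0 ≤ g x := fun x hx y hy => by
    rw [hg]; exact hA x y hx hy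
  -- Separate continuity is settled by `g`; joint boundedness comes from the same cone argument
  -- applied to the norm of `g x`.
  obtain ⟨C, hC, h⟩ := exists_bound_of_monotone_of_homogeneous (fun x => ‖g x‖)
    (fun x y hx hxy => norm_strongDual_mono (hg0 x hx) fun t ht => by
      rw [hg, hg, ← sub_nonneg, ← LinearMap.sub_apply, ← map_sub]
      exact hA _ _ (sub_nonneg.2 hxy) ht)
    (fun c x hc => by
      have : g (c • x) = c • g x := by ext y; simp [hg]
      rw [this, norm_smul, Real.norm_of_nonneg hc])
  refine ⟨A.mkContinuous₂ (2 * C) fun x y => ?_, fun x y => rfl⟩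
  have h1 : A x y = (g x⁺ - g x⁻) y := by
    rw [_root_.sub_apply, hg, hg, ← LinearMap.sub_apply, ← map_sub,
      posPart_sub_negPart]
  rw [h1]
  refine (ContinuousLinearMap.le_opNorm _ y).trans ?_
  refine mul_le_mul_of_nonneg_right ?_ (norm_nonneg y)
  calc ‖g x⁺ - g x⁻‖ ≤ ‖g x⁺‖ + ‖g x⁻‖ := norm_sub_le _ _
    _ ≤ C * ‖x⁺‖ + C * ‖x⁻‖ := add_le_add (h _ (posPart_nonneg x)) (h _ (negPart_nonneg x))
    _ ≤ C * ‖x‖ + C * ‖x‖ := by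
        gcongr
        · exact norm_posPart_le x
        · exact norm_negPart_le x
    _ = 2 * C * ‖x‖ := by ring

omit [CompleteSpace E] [IsOrderedModule ℝ E] [HasSolidNorm E] in
theorem summable_abs_of_sum_le {ψ : ℕ → StrongDual ℝ E} {φ : StrongDual ℝ E} (hψ : ∀ n, 0 ≤ ψ n)
    (h : ∀ (s : Finset ℕ) (y : E), 0 ≤ y → ∑ n ∈ s, ψ n y ≤ φ y) (y : E) :
    Summable fun n => |ψ n y| := by
  have hs : ∀ y, 0 ≤ y → Summable fun n => ψ n y := fun y hy =>
    summable_of_sum_le (fun n => hψ n y hy) fun s => h s y hy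
  refine Summable.of_nonneg_of_le (fun n => abs_nonneg _) (fun n => ?_)
    ((hs _ (posPart_nonneg y)).add (hs _ (negPart_nonneg y)))
  have h1 := hψ n _ (posPart_nonneg y)
  have h2 := hψ n _ (negPart_nonneg y)
  simp only [_root_.zero_apply] at h1 h2
  rw [← posPart_sub_negPart y, map_sub, posPart_sub_negPart y, abs_le]
  constructor <;> linarith

/-- The symmetric half graph on `ℕ`, with the even numbers on one side and the odd ones on the
other. -/
noncomputable def halfGraph (i j : ℕ) : ℝ := by
  classical
  exact if (Even i ∧ Odd j ∧ i < j) ∨ (Odd i ∧ Even j ∧ j < i) then 1 else 0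

theorem halfGraph_nonneg (i j : ℕ) : 0 ≤ halfGraph i j := by
  unfold halfGraph; split_ifs <;> norm_num

theorem halfGraph_le_one (i j : ℕ) : halfGraph i j ≤ 1 := by
  unfold halfGraph; split_ifs <;> norm_num

theorem halfGraph_comm (i j : ℕ) : halfGraph i j = halfGraph j i := by
  unfold halfGraph
  congr 1
  rw [or_comm, and_left_comm, and_left_comm (a := Even i)]

/-- Parity hides a triangular matrix, which has unequal iterated limits, in an off-diagonal block of
a symmetric one. This is why symmetric forms already suffice. -/
theorem halfGraph_even_odd (k l : ℕ) :
    halfGraph (2 * k) (2 * l + 1) = if k ≤ l then 1 else 0 := by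
  unfold halfGraph
  have h1 : ¬ Odd (2 * k) := by simp
  have h2 : Odd (2 * l + 1) := ⟨l, rfl⟩
  have h3 : Even (2 * k) := ⟨k, by ring⟩
  by_cases h : k ≤ l
  · rw [if_pos h, if_pos (Or.inl ⟨h3, h2, by omega⟩)]
  · rw [if_neg h, if_neg]
    rintro (⟨-, -, h4⟩ | ⟨h4, -⟩)
    · omega
    · exact h1 h4

omit [CompleteSpace E] in
/-- If `E` contains a sublattice isomorphic to `ℓ₁`, then the half graph is realized by a
positive symmetric bilinear form on `E` and two bounded sequences. -/
theorem exists_halfGraph_form (hE : ContainsEllOneSublattice E) :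
    ∃ (A : E →ₗ[ℝ] E →ₗ[ℝ] ℝ) (x y : ℕ → E) (M : ℝ),
      (∀ a b : E, 0 ≤ a → 0 ≤ b → 0 ≤ A a b) ∧ (∀ a b, A a b = A b a) ∧
      (∀ n, ‖x n‖ ≤ M) ∧ (∀ n, ‖y n‖ ≤ M) ∧ ∀ k l, A (x k) (y l) = if k ≤ l then 1 else 0 := by
  obtain ⟨x, M, ψ, φ, hx0, hxM, hψ0, hψx, hψφ⟩ := exists_biorthogonal_of_containsEllOneSublattice hE
  have hs := summable_abs_of_sum_le hψ0 hψφ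
  have hsum : ∀ a b : E,
      Summable fun p : ℕ × ℕ => halfGraph p.1 p.2 * (ψ p.1 a * ψ p.2 b) := by
    intro a b
    have := (hs a).mul_of_nonneg (hs b) (fun n => abs_nonneg _) fun n => abs_nonneg _
    refine Summable.of_norm_bounded this fun p => ?_
    rw [norm_mul, norm_mul, Real.norm_of_nonneg (halfGraph_nonneg _ _), Real.norm_eq_abs,
      Real.norm_eq_abs]
    exact mul_le_of_le_one_left (by positivity) (halfGraph_le_one _ _)
  let A : E →ₗ[ℝ] E →ₗ[ℝ] ℝ := LinearMap.mk₂ ℝ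
    (fun a b => ∑' p : ℕ × ℕ, halfGraph p.1 p.2 * (ψ p.1 a * ψ p.2 b))
    (fun a a' b => by
      rw [← (hsum a b).tsum_add (hsum a' b)]
      exact tsum_congr fun p => by rw [map_add]; ring)
    (fun c a b => by
      rw [← (hsum a b).tsum_const_smul c]
      exact tsum_congr fun p => by rw [map_smul, smul_eq_mul, smul_eq_mul]; ring)
    (fun a b b' => by
      rw [← (hsum a b).tsum_add (hsum a b')]
      exact tsum_congr fun p => by rw [map_add]; ring)
    (fun c a b => by
      rw [← (hsum a b).tsum_const_smul c]
      exact tsum_congr fun p => by rw [map_smul, smul_eq_mul, smul_eq_mul]; ring)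
  have hA : ∀ a b, A a b = ∑' p : ℕ × ℕ, halfGraph p.1 p.2 * (ψ p.1 a * ψ p.2 b) :=
    fun a b => rfl
  refine ⟨A, fun n => x (2 * n), fun n => x (2 * n + 1), M, fun a b ha hb => ?_, fun a b => ?_,
    fun n => hxM _, fun n => hxM _, fun k l => ?_⟩
  · exact tsum_nonneg fun p => mul_nonneg (halfGraph_nonneg _ _)
      (mul_nonneg (hψ0 _ _ ha) (hψ0 _ _ hb))
  · rw [hA, hA, ← (Equiv.prodComm ℕ ℕ).tsum_eq]
    exact tsum_congr fun p => by
      simp only [Equiv.prodComm_apply, Prod.fst_swap, Prod.snd_swap]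
      rw [halfGraph_comm]; ring
  · rw [hA, tsum_eq_single (2 * k, 2 * l + 1), hψx, hψx, halfGraph_even_odd]
    · simp
    · rintro ⟨i, j⟩ hp
      rw [hψx, hψx]
      by_cases hi : i = 2 * k
      · have hj : j ≠ 2 * l + 1 := fun hj => hp (by rw [hi, hj])
        simp [hj]
      · simp [hi]

-- The weak* limits `z`, `w` of the two sequences give `1` when the limit over `l` is taken first
-- and `0` when the limit over `k` is.
omit [CompleteSpace E] in
theorem not_containsEllOneSublattice_of_symmetric_regular
    (h : ∀ A : E →ₗ[ℝ] E →ₗ[ℝ] ℝ, (∀ x y : E, 0 ≤ x → 0 ≤ y → 0 ≤ A x y) →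
      (∀ x y : E, A x y = A y x) → IsArensRegular A) : ¬ ContainsEllOneSublattice E := by
  intro hE
  obtain ⟨A, x, y, M, hA, hAs, hx, hy, hxy⟩ := exists_halfGraph_form hE
  obtain ⟨B, hB, hreg⟩ := (h A hA hAs).exists_eq
  let U : Ultrafilter ℕ := hyperfilter ℕ
  have hU : (U : Filter ℕ) ≤ atTop := Nat.hyperfilter_le_atTop
  obtain ⟨z, hz⟩ := exists_bidual_limit U x (Eventually.of_forall hx)
  obtain ⟨w, hw⟩ := exists_bidual_limit U y (Eventually.of_forall hy)
  have h1 : ∀ k, w (B (x k)) = 1 := fun k => by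
    refine tendsto_nhds_unique (hw (B (x k))) (tendsto_const_nhds.congr' ?_)
    filter_upwards [hU (eventually_ge_atTop k)] with l hl
    rw [hB, hxy, if_pos hl]
  have h2 : ∀ l, z (B.flip (y l)) = 0 := fun l => by
    refine tendsto_nhds_unique (hz (B.flip (y l))) (tendsto_const_nhds.congr' ?_)
    filter_upwards [hU (eventually_gt_atTop l)] with k hk
    rw [ContinuousLinearMap.flip_apply, hB, hxy, if_neg (not_le.2 hk)]
  have h3 : z (w ∘L B) = 1 :=
    tendsto_nhds_unique (hz (w ∘L B)) (tendsto_const_nhds.congr fun k => (h1 k).symm)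
  have h4 : w (z ∘L B.flip) = 0 :=
    tendsto_nhds_unique (hw (z ∘L B.flip)) (tendsto_const_nhds.congr fun k => (h2 k).symm)
  rw [hreg, h4] at h3
  exact zero_ne_one h3

/-- A weak limit `g` of the images of `x k` vanishes at every `y l`, so `w g = 0`; but `w` equals
`1` on each image, so `w g = 1`. -/
theorem not_containsEllOneSublattice_of_weaklyCompact
    (h : ∀ T : E →ₗ[ℝ] StrongDual ℝ E, (∀ x : E, 0 ≤ x → 0 ≤ T x) →
      IsWeaklyCompactOperator T) : ¬ ContainsEllOneSublattice E := by
  intro hE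
  obtain ⟨A, x, y, M, hA, -, hx, hy, hxy⟩ := exists_halfGraph_form hE
  obtain ⟨B, hB⟩ := exists_continuous_bilinear_eq A hA
  have hT := h (B : E →ₗ[ℝ] StrongDual ℝ E) fun a ha b hb => by
    change 0 ≤ B a b
    rw [hB]; exact hA a b ha hb
  let U : Ultrafilter ℕ := hyperfilter ℕ
  have hU : (U : Filter ℕ) ≤ atTop := Nat.hyperfilter_le_atTop
  obtain ⟨g, hg⟩ := hT.exists_weak_limit U x hx
  obtain ⟨w, hw⟩ := exists_bidual_limit U y (Eventually.of_forall hy)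
  have h1 : ∀ k, w (B (x k)) = 1 := fun k => by
    refine tendsto_nhds_unique (hw (B (x k))) (tendsto_const_nhds.congr' ?_)
    filter_upwards [hU (eventually_ge_atTop k)] with l hl
    rw [hB, hxy, if_pos hl]
  have h2 : ∀ l, g (y l) = 0 := fun l => by
    refine tendsto_nhds_unique (hg (NormedSpace.inclusionInDoubleDual ℝ E (y l)))
      (tendsto_const_nhds.congr' ?_)
    filter_upwards [hU (eventually_gt_atTop l)] with k hk
    change 0 = B (x k) (y l)
    rw [hB, hxy, if_neg (not_le.2 hk)]
  have h3 : w g = 1 :=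
    tendsto_nhds_unique (hg w) (tendsto_const_nhds.congr fun k => (h1 k).symm)
  have h4 : w g = 0 :=
    tendsto_nhds_unique (hw g) (tendsto_const_nhds.congr fun k => (h2 k).symm)
  rw [h4] at h3
  exact zero_ne_one h3

/-- The tails `g n = ∑ ψ i` over `i ≥ n` decrease to `0` pointwise on the cone, yet `g n (x n) ≥ 1`
with `x n` bounded. -/
theorem not_containsEllOneSublattice_of_hasOrderContinuousNorm
    (h : HasOrderContinuousNorm (StrongDual ℝ E)) : ¬ ContainsEllOneSublattice E := by
  intro hE
  obtain ⟨x, M, ψ, φ, hx0, hxM, hψ0, hψx, hψφ⟩ := exists_biorthogonal_of_containsEllOneSublattice hE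
  have hs : ∀ y, Summable fun n => ψ n y := fun y => (summable_abs_of_sum_le hψ0 hψφ y).of_abs
  have hsn : ∀ n y, Summable fun i => ψ (i + n) y := fun n y => (summable_nat_add_iff n).2 (hs y)
  have htail : ∀ n : ℕ, ∃ g : StrongDual ℝ E, ∀ y, g y = ∑' i, ψ (i + n) y := fun n => by
    let G : E →ₗ[ℝ] ℝ :=
      { toFun := fun y => ∑' i, ψ (i + n) y
        map_add' := fun a b => by
          rw [← (hsn n a).tsum_add (hsn n b)]
          simp
        map_smul' := fun c a => by
          rw [RingHom.id_apply, ← (hsn n a).tsum_const_smul c]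
          simp }
    exact exists_strongDual_eq G fun y hy => tsum_nonneg fun i => hψ0 _ y hy
  choose g hg using htail
  have hanti : Antitone g := antitone_nat_of_succ_le fun n y hy => by
    rw [hg, hg, (hsn n y).tsum_eq_zero_add]
    have h0 := hψ0 (0 + n) y hy
    have h1 : ∀ i, i + 1 + n = i + (n + 1) := fun i => by ring
    simp only [h1]
    exact le_add_of_nonneg_left h0
  have hg0 : ∀ n, 0 ≤ g n := fun n y hy => by
    rw [hg]; exact tsum_nonneg fun i => hψ0 _ y hy
  have hglb : IsGLB (Set.range g) 0 := by
    refine ⟨?_, fun k hk y hy => ?_⟩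
    · rintro _ ⟨n, rfl⟩
      exact hg0 n
    · refine ge_of_tendsto' (tendsto_sum_nat_add fun n => ψ n y) fun n => ?_
      rw [← hg]
      exact hk ⟨n, rfl⟩ y hy
  have hdir : DirectedOn (· ≥ ·) (Set.range g) :=
    directedOn_range.2 (hanti.directed_ge)
  have hlim := h (Set.range g) ⟨g 0, 0, rfl⟩ hdir hglb
  have hM : 0 ≤ M := (norm_nonneg _).trans (hxM 0)
  have : Nonempty (Set.range g) := ⟨⟨g 0, 0, rfl⟩⟩
  have : IsCodirectedOrder (Set.range g) := ⟨fun a b => by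
    obtain ⟨c, hc, h1, h2⟩ := hdir a a.2 b b.2
    exact ⟨⟨c, hc⟩, h1, h2⟩⟩
  obtain ⟨d, hd⟩ := (hlim.eventually (gt_mem_nhds (show (0 : ℝ) < 1 / (M + 1) by
    positivity))).exists_forall_of_atBot
  obtain ⟨_, n, rfl⟩ := d
  have h1 := hd _ le_rfl
  have h2 : 1 ≤ g n (x n) := by
    rw [hg]
    refine le_trans ?_ ((hsn n (x n)).le_tsum 0 fun i _ => hψ0 _ _ (hx0 n))
    simp [hψx]
  have h3 : g n (x n) ≤ ‖g n‖ * M := (le_abs_self _).trans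
    (((g n).le_opNorm _).trans (mul_le_mul_of_nonneg_left (hxM n) (norm_nonneg _)))
  change ‖g n‖ < 1 / (M + 1) at h1
  rw [lt_div_iff₀ (by positivity)] at h1
  nlinarith [norm_nonneg (g n)]

end NegativeResults

/-! ### Goldstine's theorem and limits along ultrafilters. -/

section Goldstine

variable {X : Type*} [NormedAddCommGroup X] [NormedSpace ℝ X]

/-- Otherwise Hahn–Banach in `ℝ^F` gives a combination `g` of the members of `F` with `g < c` on the
ball of radius `‖z‖ + 1` but `z g > c`; then `‖g‖ ≤ c / (‖z‖ + 1)` contradicts `z g ≤ ‖z‖ * ‖g‖`. -/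
theorem exists_approx_bidual (z : StrongDual ℝ (StrongDual ℝ X)) (F : Finset (StrongDual ℝ X))
    {ε : ℝ} (hε : 0 < ε) : ∃ x : X, ‖x‖ ≤ ‖z‖ + 1 ∧ ∀ f ∈ F, |f x - z f| < ε := by
  classical
  let Φ : X →L[ℝ] (F → ℝ) := ContinuousLinearMap.pi fun f => (f : StrongDual ℝ X)
  let K : Set (F → ℝ) := closure (Φ '' Metric.closedBall 0 (‖z‖ + 1))
  have hK : (fun f : F => z f) ∈ K := by
    by_contra hnot
    obtain ⟨l, c, hlc, hl⟩ := geometric_hahn_banach_closed_point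
      (((convex_closedBall (0 : X) (‖z‖ + 1)).linear_image Φ.toLinearMap).closure)
      isClosed_closure hnot
    let g : StrongDual ℝ X := l ∘L Φ
    have hg : ∀ x, ‖x‖ ≤ ‖z‖ + 1 → g x < c := fun x hx =>
      hlc _ (subset_closure ⟨x, by simpa using hx, rfl⟩)
    have hzg : l (fun f : F => z f) = z g := by
      have h1 : ∀ y : F → ℝ, l y = ∑ f, y f * l (Pi.single f 1) := fun y => by
        conv_lhs => rw [pi_eq_sum_univ' y]
        simp
      have h2 : g = ∑ f : F, l (Pi.single f 1) • (f : StrongDual ℝ X) := by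
        ext x
        change l (Φ x) = _
        rw [h1]
        simp [Φ, mul_comm]
      rw [h1, h2, map_sum]
      exact Finset.sum_congr rfl fun f _ => by rw [map_smul, smul_eq_mul, mul_comm]
    have hc : 0 < c := by simpa using hg 0 (by simp; positivity)
    have hnorm : ‖g‖ ≤ c / (‖z‖ + 1) := by
      refine g.opNorm_le_of_unit_norm (by positivity) fun x hx => ?_
      have h0 : (0 : ℝ) < ‖z‖ + 1 := by positivity
      rw [le_div_iff₀' h0, Real.norm_eq_abs, ← abs_of_pos h0, ← abs_mul, abs_le']
      have h3 : ∀ y : X, ‖y‖ = 1 → (‖z‖ + 1) * g y ≤ c := fun y hy => by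
        have := hg ((‖z‖ + 1) • y) (by rw [norm_smul, hy, Real.norm_of_nonneg h0.le, mul_one])
        rw [map_smul, smul_eq_mul] at this
        exact this.le
      exact ⟨h3 x hx, by simpa using h3 (-x) (by simpa using hx)⟩
    have h4 : z g ≤ ‖z‖ * ‖g‖ := (le_abs_self _).trans (z.le_opNorm g)
    rw [hzg] at hl
    have h5 : ‖z‖ * ‖g‖ ≤ ‖z‖ * (c / (‖z‖ + 1)) := by gcongr
    have h6 : ‖z‖ * (c / (‖z‖ + 1)) ≤ c := by
      rw [mul_div_assoc', div_le_iff₀ (by positivity)]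
      nlinarith
    linarith
  obtain ⟨_, ⟨x, hx, rfl⟩, hd⟩ := Metric.mem_closure_iff.1 hK ε hε
  refine ⟨x, by simpa using hx, fun f hf => ?_⟩
  have := (dist_pi_lt_iff hε).1 hd ⟨f, hf⟩
  rw [dist_comm] at this
  exact this

/-- `z` is the weak* limit in the bidual of an ultrafilter on `S`. -/
def IsBidualLimit (S : Set X) (z : StrongDual ℝ (StrongDual ℝ X)) : Prop :=
  ∃ U : Ultrafilter X, S ∈ U ∧ ∀ f : StrongDual ℝ X, Tendsto (fun x => f x) U (𝓝 (z f))

/-- **Goldstine's theorem**. -/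
theorem isBidualLimit_closedBall (z : StrongDual ℝ (StrongDual ℝ X)) :
    IsBidualLimit {x : X | ‖x‖ ≤ ‖z‖ + 1} z := by
  classical
  choose x hx hxz using fun p : Finset (StrongDual ℝ X) × ℕ =>
    exists_approx_bidual z p.1 (ε := 1 / ((p.2 : ℝ) + 1)) (by positivity)
  let U : Ultrafilter (Finset (StrongDual ℝ X) × ℕ) := Ultrafilter.of atTop
  have hU : (U : Filter (Finset (StrongDual ℝ X) × ℕ)) ≤ atTop := Ultrafilter.of_le _
  refine ⟨U.map x, Ultrafilter.mem_map.2 (Filter.univ_mem' hx), fun f => ?_⟩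
  rw [Ultrafilter.coe_map, tendsto_map'_iff]
  refine Tendsto.mono_left ?_ hU
  rw [tendsto_iff_dist_tendsto_zero]
  have h1 : Tendsto (fun p : Finset (StrongDual ℝ X) × ℕ => 1 / ((p.2 : ℝ) + 1)) atTop (𝓝 0) := by
    rw [← prod_atTop_atTop_eq]
    exact tendsto_one_div_add_atTop_nhds_zero_nat.comp tendsto_snd
  refine squeeze_zero' (Eventually.of_forall fun p => dist_nonneg) ?_ h1
  filter_upwards [eventually_ge_atTop ({f}, 0)] with p hp
  exact (hxz p f (hp.1 (Finset.mem_singleton_self f))).le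

variable {S : Set X} {z : StrongDual ℝ (StrongDual ℝ X)}

theorem IsBidualLimit.mono {S' : Set X} (hz : IsBidualLimit S z) (h : S ⊆ S') :
    IsBidualLimit S' z := by
  obtain ⟨U, hU, hlim⟩ := hz
  exact ⟨U, Filter.mem_of_superset hU h, hlim⟩

theorem IsBidualLimit.neg (hz : IsBidualLimit S z) : IsBidualLimit (Neg.neg '' S) (-z) := by
  obtain ⟨U, hU, hlim⟩ := hz
  refine ⟨U.map Neg.neg, Filter.image_mem_map hU, fun f => ?_⟩
  rw [Ultrafilter.coe_map, tendsto_map'_iff]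
  refine (hlim f).neg.congr fun x => ?_
  simp

theorem IsBidualLimit.exists_approx (hz : IsBidualLimit S z) (F : Finset (StrongDual ℝ X)) {ε : ℝ}
    (hε : 0 < ε) : ∃ x ∈ S, ∀ f ∈ F, |f x - z f| < ε := by
  obtain ⟨U, hU, hlim⟩ := hz
  have h : ∀ᶠ x in (U : Filter X), ∀ f ∈ F, |f x - z f| < ε :=
    (Filter.eventually_all_finset F).2 fun f _ => Metric.tendsto_nhds.1 (hlim f) ε hε
  obtain ⟨x, hx, hxf⟩ := Ultrafilter.nonempty_of_mem (Filter.inter_mem hU h)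
  exact ⟨x, hx, hxf⟩

theorem IsBidualLimit.le_of_forall (hz : IsBidualLimit S z) {f : StrongDual ℝ X} {c : ℝ}
    (h : ∀ x ∈ S, f x ≤ c) : z f ≤ c := by
  obtain ⟨U, hU, hlim⟩ := hz
  exact le_of_tendsto (hlim f) (Filter.mem_of_superset hU h)

theorem IsBidualLimit.ge_of_forall (hz : IsBidualLimit S z) {f : StrongDual ℝ X} {c : ℝ}
    (h : ∀ x ∈ S, c ≤ f x) : c ≤ z f := by
  obtain ⟨U, hU, hlim⟩ := hz
  exact ge_of_tendsto (hlim f) (Filter.mem_of_superset hU h)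

/-- Nonlinear lattice maps act on nets rather than on the bidual: push the ultrafilter forward under
`p` and under `x ↦ x - p x`. It is used for positive parts and for truncation. -/
theorem IsBidualLimit.exists_add (hz : IsBidualLimit S z) (p : X → X) {M : ℝ}
    (hp : ∀ x ∈ S, ‖p x‖ ≤ M) : ∃ z₁ z₂, z = z₁ + z₂ ∧ IsBidualLimit (p '' S) z₁ ∧
      IsBidualLimit ((fun x => x - p x) '' S) z₂ := by
  obtain ⟨U, hU, hlim⟩ := hz
  obtain ⟨z₁, hz₁⟩ := exists_bidual_limit U p (Filter.mem_of_superset hU hp)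
  refine ⟨z₁, z - z₁, by abel, ⟨U.map p, Filter.image_mem_map hU, fun f => ?_⟩,
    ⟨U.map _, Filter.image_mem_map hU, fun f => ?_⟩⟩
  · rw [Ultrafilter.coe_map, tendsto_map'_iff]
    exact hz₁ f
  · rw [Ultrafilter.coe_map, tendsto_map'_iff]
    refine ((hlim f).sub (hz₁ f)).congr fun x => ?_
    simp

end Goldstine

/-! ### Energy decrement, truncation and Arens regularity. -/

section Regularity

variable {E : Type*} [NormedAddCommGroup E] [NormedSpace ℝ E] [Lattice E] [IsOrderedAddMonoid E]

/-- `c` bounds the squared `L²`-norm over `[0, v]` of the density of `h` with respect to `f`. -/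
def EnergyLE (f h : StrongDual ℝ E) (v : E) (c : ℝ) : Prop :=
  ∀ (ι : Type) [Fintype ι] (p : ι → E) (t : ι → ℝ), (∀ i, 0 ≤ p i) → ∑ i, p i = v →
    ∑ i, (2 * t i * h (p i) - t i ^ 2 * f (p i)) ≤ c

-- A density in `[0, 1]` has square integral at most `f v`; termwise, `f - 2th + t²f = (t - 1)² h +
-- (1 + t²)(f - h)`.
omit [IsOrderedAddMonoid E] in
theorem energyLE_of_le {f h : StrongDual ℝ E} (hh : ∀ x, 0 ≤ x → 0 ≤ h x)
    (hhf : ∀ x, 0 ≤ x → h x ≤ f x) (v : E) : EnergyLE f h v (f v) := by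
  intro ι _ p t hp hpv
  rw [← hpv, map_sum]
  refine Finset.sum_le_sum fun i _ => ?_
  have h1 := hh _ (hp i)
  have h2 := hhf _ (hp i)
  nlinarith [mul_nonneg (sq_nonneg (t i - 1)) h1, mul_nonneg (sq_nonneg (t i)) (sub_nonneg.2 h2)]

/-- Parallelogram inequality for the energy. -/
theorem EnergyLE.midpoint {f l r : StrongDual ℝ E} {v : E} {c : ℝ} (hl : EnergyLE f l v c)
    (hr : EnergyLE f r v c) {b : E} (hb : 0 ≤ b) (hbv : b ≤ v) (σ : ℝ) :
    EnergyLE f ((1 / 2 : ℝ) • (l + r)) v (c - (σ * (l b - r b) - σ ^ 2 * f b)) := by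
  intro ι _ p t hp hpv
  obtain ⟨q, hq, hqb⟩ := exists_riesz_decomposition Finset.univ p hp hb (hpv ▸ hbv)
  have hpos : ∀ i : ι ⊕ ι, 0 ≤ Sum.elim q (fun i => p i - q i) i := by
    rintro (i | i)
    · exact (hq i).1
    · exact sub_nonneg.2 (hq i).2
  have hsum : ∑ i : ι ⊕ ι, Sum.elim q (fun i => p i - q i) i = v := by
    rw [Fintype.sum_sum_type]
    simp [hpv]
  -- Refine the partition along `b` and shift the test value on the pieces `q i` by `σ` for `l` and
  -- by `-σ` for `r`. On adding, the terms in `t * σ * f` cancel and the gain from `l b - r b`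
  -- remains.
  have h1 := hl (ι ⊕ ι) _ (Sum.elim (fun i => t i + σ) t) hpos hsum
  have h2 := hr (ι ⊕ ι) _ (Sum.elim (fun i => t i - σ) t) hpos hsum
  rw [Fintype.sum_sum_type, ← Finset.sum_add_distrib] at h1 h2
  simp only [Sum.elim_inl, Sum.elim_inr] at h1 h2
  have hlb : l b = ∑ i, l (q i) := by rw [← hqb, map_sum]
  have hrb : r b = ∑ i, r (q i) := by rw [← hqb, map_sum]
  have hfb : f b = ∑ i, f (q i) := by rw [← hqb, map_sum]
  have h3 := add_le_add h1 h2
  rw [← Finset.sum_add_distrib] at h3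
  have h4 : ∑ i, (2 * t i * ((1 / 2 : ℝ) • (l + r)) (p i) - t i ^ 2 * f (p i)) * 2 +
      2 * (σ * (l b - r b) - σ ^ 2 * f b) ≤ c + c := by
    refine le_trans (le_of_eq ?_) h3
    rw [hlb, hrb, hfb, ← Finset.sum_sub_distrib, Finset.mul_sum, Finset.mul_sum,
      ← Finset.sum_sub_distrib, Finset.mul_sum, ← Finset.sum_add_distrib]
    refine Finset.sum_congr rfl fun i _ => ?_
    simp only [_root_.smul_apply, _root_.add_apply, smul_eq_mul, map_sub]
    ring
  rw [← Finset.sum_mul] at h4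
  linarith

/-- Positive bilinear forms commute with iterated limits over order intervals. -/
theorem bidual_eq_of_order_bounded [IsOrderedModule ℝ E] {B : E →L[ℝ] E →L[ℝ] ℝ}
    (hB : ∀ x y, 0 ≤ x → 0 ≤ y → 0 ≤ B x y) {u v : E}
    (hv : 0 ≤ v) {z w : StrongDual ℝ (StrongDual ℝ E)} (hz : IsBidualLimit (Set.Icc 0 u) z)
    (hw : IsBidualLimit (Set.Icc 0 v) w) : z (w ∘L B) = w (z ∘L B.flip) := by
  classical
  by_contra hne
  set b₀ := z (w ∘L B) with hb₀
  set c₀ := w (z ∘L B.flip) with hc₀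
  set η := |b₀ - c₀| / 8 with hη
  have hη0 : 0 < η := by
    have : 0 < |b₀ - c₀| := abs_pos.2 (sub_ne_zero.2 hne)
    positivity
  have hmono : ∀ x y, 0 ≤ x ∧ x ≤ u → 0 ≤ y → B x y ≤ B u y := fun x y hx hy => by
    have := hB (u - x) y (sub_nonneg.2 hx.2) hy
    simpa using this
  have hu : 0 ≤ u := by
    obtain ⟨x, hx, -⟩ := hz.exists_approx ∅ one_pos
    exact hx.1.trans hx.2
  have hfv : 0 ≤ B u v := hB u v hu hv
  set κ := (4 * η) ^ 2 / (4 * (B u v + 1)) with hκ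
  have hκ0 : 0 < κ := by positivity
  -- The approximation clause holds for all `F` and `ε`, so that both halves of a midpoint can be
  -- required to test well against functionals chosen during the step.
  have key : ∀ (n : ℕ) (F : Finset (StrongDual ℝ E)) (ε : ℝ), 0 < ε → ∃ a ∈ Set.Icc 0 u,
      (∀ g ∈ F, |g a - z g| < ε) ∧ EnergyLE (B u) (B a) v (B u v - n * κ) := by
    intro n
    induction n with
    | zero =>
      intro F ε hε
      obtain ⟨a, ha, haF⟩ := hz.exists_approx F hε
      refine ⟨a, ha, haF, ?_⟩
      simpa using energyLE_of_le (fun x hx => hB a x ha.1 hx) (fun x hx => hmono a x ha hx) v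
    | succ n ih =>
      intro F ε hε
      -- The order `l`, `b`, `r` matters: `B l b` is close to `w (B l)`, hence to `b₀`, while `B r
      -- b` is close to `z (B.flip b)`, hence to `c₀`. Four errors of `η` out of a distance `8 * η`
      -- leave a gap of `4 * η`.
      obtain ⟨l, hl, hlF, hlE⟩ := ih (insert (w ∘L B) F) (min ε η) (lt_min hε hη0)
      obtain ⟨b, hb, hbF⟩ := hw.exists_approx {B l, z ∘L B.flip} hη0
      obtain ⟨r, hr, hrF, hrE⟩ := ih (insert (B.flip b) F) (min ε η) (lt_min hε hη0)
      have h1 := (hlF _ (Finset.mem_insert_self _ _)).trans_le (min_le_right _ _)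
      have h2 := hbF (B l) (by simp)
      have h3 := hbF (z ∘L B.flip) (by simp)
      have h4 := (hrF _ (Finset.mem_insert_self _ _)).trans_le (min_le_right _ _)
      simp only [ContinuousLinearMap.comp_apply, ContinuousLinearMap.flip_apply] at h1 h2 h3 h4
      rw [← hb₀] at h1
      rw [← hc₀] at h3
      have hgap : 4 * η ≤ |B l b - B r b| := by
        have h5 : |b₀ - c₀| ≤ |B l b - B r b| + 4 * η := by
          rw [abs_lt] at h1 h2 h3 h4
          have h6 := le_abs_self (B l b - B r b)
          have h7 := neg_abs_le (B l b - B r b)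
          rw [abs_le]
          constructor <;> linarith
        linarith
      refine ⟨(1 / 2 : ℝ) • (l + r), ⟨smul_nonneg (by norm_num) (add_nonneg hl.1 hr.1), ?_⟩,
        fun g hg => ?_, ?_⟩
      · calc (1 / 2 : ℝ) • (l + r) ≤ (1 / 2 : ℝ) • (u + u) :=
              smul_le_smul_of_nonneg_left (add_le_add hl.2 hr.2) (by norm_num)
          _ = u := by rw [← two_smul ℝ u, smul_smul]; norm_num
      · have h5 := (hlF g (Finset.mem_insert_of_mem hg)).trans_le (min_le_left _ _)
        have h6 := (hrF g (Finset.mem_insert_of_mem hg)).trans_le (min_le_left _ _)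
        rw [map_smul, map_add, smul_eq_mul]
        rw [abs_lt] at h5 h6 ⊢
        constructor <;> linarith
      · set d := B l b - B r b with hd
        -- This `σ` maximizes `σ * d - σ ^ 2 * K` for `K = B u v + 1`, an upper bound for `B u b`
        -- kept positive by the `1`.
        have h5 := hlE.midpoint hrE hb.1 hb.2 (d / (2 * (B u v + 1)))
        rw [map_smul, map_add]
        intro ι _ p t hp hpv
        refine (h5 ι p t hp hpv).trans ?_
        have hfb : B u b ≤ B u v + 1 := by
          have := hB u (v - b) hu (sub_nonneg.2 hb.2)
          rw [map_sub] at this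
          linarith
        have h6 : κ ≤ d / (2 * (B u v + 1)) * d - (d / (2 * (B u v + 1))) ^ 2 * B u b := by
          have h7 : (d / (2 * (B u v + 1))) ^ 2 * B u b ≤
              (d / (2 * (B u v + 1))) ^ 2 * (B u v + 1) := by gcongr
          have h8 : (d / (2 * (B u v + 1))) ^ 2 * (B u v + 1) = d ^ 2 / (4 * (B u v + 1)) := by
            field_simp
            norm_num
          have h9 : d / (2 * (B u v + 1)) * d = 2 * (d ^ 2 / (4 * (B u v + 1))) := by
            field_simp
            norm_num
          have h10 : κ ≤ d ^ 2 / (4 * (B u v + 1)) := by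
            rw [hκ, ← sq_abs d]
            gcongr
          linarith
        push_cast
        linarith
  obtain ⟨n, hn⟩ := exists_nat_gt (B u v / κ)
  rw [div_lt_iff₀ hκ0] at hn
  obtain ⟨a, -, -, ha⟩ := key n ∅ 1 one_pos
  -- The zero test function shows that no energy bound can be negative.
  have := ha Unit (fun _ => v) (fun _ => 0) (fun _ => hv) (by simp)
  simp at this
  linarith

variable [IsOrderedModule ℝ E] [HasSolidNorm E]

-- Take limits of the positive and negative parts along a Goldstine net; no lattice structure on the
-- bidual is needed.
omit [IsOrderedModule ℝ E] in
theorem exists_sub_of_bidual (z : StrongDual ℝ (StrongDual ℝ E)) :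
    ∃ (M : ℝ) (p q : StrongDual ℝ (StrongDual ℝ E)), z = p - q ∧
      IsBidualLimit {x : E | 0 ≤ x ∧ ‖x‖ ≤ M} p ∧ IsBidualLimit {x : E | 0 ≤ x ∧ ‖x‖ ≤ M} q := by
  obtain ⟨z₁, z₂, rfl, h₁, h₂⟩ := (isBidualLimit_closedBall z).exists_add (fun x => x⁺)
    (fun x hx => (norm_posPart_le x).trans hx)
  refine ⟨‖z₁ + z₂‖ + 1, z₁, -z₂, by abel, h₁.mono ?_, h₂.neg.mono ?_⟩
  · rintro _ ⟨x, hx, rfl⟩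
    exact ⟨posPart_nonneg x, (norm_posPart_le x).trans hx⟩
  · rintro _ ⟨_, ⟨x, hx, rfl⟩, rfl⟩
    have h : -(x - x⁺) = x⁻ := by
      rw [neg_sub, sub_eq_iff_eq_add', ← sub_eq_iff_eq_add, posPart_sub_negPart]
    rw [h]
    exact ⟨negPart_nonneg x, (norm_negPart_le x).trans hx⟩

/-- A limit of a bounded net of positive elements splits into a part in an order interval and a part
on which a given functional is small. -/
theorem IsBidualLimit.exists_truncation [CompleteSpace E] (hE : ¬ ContainsEllOneSublattice E)
    {z : StrongDual ℝ (StrongDual ℝ E)} {M : ℝ} (hz : IsBidualLimit {x : E | 0 ≤ x ∧ ‖x‖ ≤ M} z)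
    {f : StrongDual ℝ E} (hf : 0 ≤ f) {ε : ℝ} (hε : 0 < ε) :
    ∃ u z₁ z₂, 0 ≤ u ∧ z = z₁ + z₂ ∧ IsBidualLimit (Set.Icc 0 u) z₁ ∧
      IsBidualLimit {x : E | 0 ≤ x} z₂ ∧ z₂ f ≤ ε := by
  obtain ⟨u, hu, huM⟩ := exists_approx_order_bound hE hf hε M
  obtain ⟨z₁, z₂, rfl, h₁, h₂⟩ := hz.exists_add (fun x => x ⊓ u) (M := M)
    (fun x hx => (norm_le_norm_of_nonneg_of_le (le_inf hx.1 hu) inf_le_left).trans hx.2)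
  refine ⟨u, z₁, z₂, hu, rfl, h₁.mono ?_, h₂.mono ?_, h₂.le_of_forall ?_⟩
  · rintro _ ⟨x, hx, rfl⟩
    exact ⟨le_inf hx.1 hu, inf_le_right⟩
  · rintro _ ⟨x, hx, rfl⟩
    exact sub_nonneg.2 inf_le_left
  · rintro _ ⟨x, hx, rfl⟩
    change f (x - x ⊓ u) ≤ ε
    rw [← posPart_sub_eq_sub_inf]
    exact huM x hx.1 hx.2

omit [HasSolidNorm E] [IsOrderedModule ℝ E] in
theorem IsBidualLimit.mono_apply {z : StrongDual ℝ (StrongDual ℝ E)}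
    (hz : IsBidualLimit {x : E | 0 ≤ x} z) {f g : StrongDual ℝ E} (hfg : f ≤ g) : z f ≤ z g := by
  have : 0 ≤ z (g - f) := hz.ge_of_forall fun x hx => by
    simpa using hfg x hx
  simpa using this

variable [CompleteSpace E] {B : E →L[ℝ] E →L[ℝ] ℝ} {z w : StrongDual ℝ (StrongDual ℝ E)} {M : ℝ}

/-- Truncate `w` at precision `ε` for `B u`, which dominates `B x` for all `x` in `[0, u]`: the
remainder contributes between `0` and `ε` to either side. -/
theorem bidual_eq_of_left_order_bounded (hE : ¬ ContainsEllOneSublattice E)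
    (hB : ∀ x y, 0 ≤ x → 0 ≤ y → 0 ≤ B x y) {u : E} (hu : 0 ≤ u)
    (hz : IsBidualLimit (Set.Icc 0 u) z) (hw : IsBidualLimit {x : E | 0 ≤ x ∧ ‖x‖ ≤ M} w) :
    z (w ∘L B) = w (z ∘L B.flip) := by
  refine eq_of_forall_dist_le fun ε hε => ?_
  obtain ⟨v, w₁, w₂, hv, rfl, hw₁, hw₂, hwε⟩ :=
    hw.exists_truncation hE (f := B u) (fun y hy => hB u y hu hy) hε
  have hmono : ∀ x ∈ Set.Icc 0 u, 0 ≤ B x ∧ B x ≤ B u := fun x hx =>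
    ⟨fun y hy => hB x y hx.1 hy, fun y hy => by
      simpa using hB (u - x) y (sub_nonneg.2 hx.2) hy⟩
  have hzero : (0 : ℝ) = w₂ 0 := (map_zero w₂).symm
  have h1 : 0 ≤ z (w₂ ∘L B) := hz.ge_of_forall fun x hx => by
    rw [hzero]; exact hw₂.mono_apply (hmono x hx).1
  have h2 : z (w₂ ∘L B) ≤ ε := hz.le_of_forall fun x hx =>
    (hw₂.mono_apply (hmono x hx).2).trans hwε
  have h3 : 0 ≤ w₂ (z ∘L B.flip) := by
    rw [hzero]
    exact hw₂.mono_apply fun y hy => hz.ge_of_forall fun x hx => hB x y hx.1 hy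
  have h4 : w₂ (z ∘L B.flip) ≤ ε := by
    refine (hw₂.mono_apply (g := B u) fun y hy => ?_).trans hwε
    exact hz.le_of_forall fun x hx => (hmono x hx).2 y hy
  have h5 : (w₁ + w₂) ∘L B = w₁ ∘L B + w₂ ∘L B := by ext; rfl
  have h6 := bidual_eq_of_order_bounded hB hv hz hw₁
  rw [h5, map_add, _root_.add_apply, h6, Real.dist_eq, abs_le]
  constructor <;> linarith

/-- Truncating `z` against `w ∘L B` controls the remainder on the left only; on the right it is
merely nonnegative, which is enough for an inequality. Applying this to `B.flip` gives the converse.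
-/
theorem bidual_le_of_nonneg (hE : ¬ ContainsEllOneSublattice E)
    (hB : ∀ x y, 0 ≤ x → 0 ≤ y → 0 ≤ B x y)
    (hz : IsBidualLimit {x : E | 0 ≤ x ∧ ‖x‖ ≤ M} z)
    {M' : ℝ} (hw : IsBidualLimit {x : E | 0 ≤ x ∧ ‖x‖ ≤ M'} w) :
    z (w ∘L B) ≤ w (z ∘L B.flip) := by
  refine le_of_forall_pos_le_add fun ε hε => ?_
  have hwB : (0 : StrongDual ℝ E) ≤ w ∘L B := fun x hx =>
    hw.ge_of_forall fun y hy => hB x y hx hy.1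
  obtain ⟨u, z₁, z₂, hu, rfl, hz₁, hz₂, hzε⟩ := hz.exists_truncation hE hwB hε
  have h1 : 0 ≤ w (z₂ ∘L B.flip) := hw.ge_of_forall fun y hy =>
    hz₂.ge_of_forall fun x hx => hB x y hx hy.1
  have h2 : (z₁ + z₂) ∘L B.flip = z₁ ∘L B.flip + z₂ ∘L B.flip := by ext; rfl
  rw [h2, map_add, _root_.add_apply, bidual_eq_of_left_order_bounded hE hB hu hz₁ hw]
  linarith

theorem bidual_eq_of_nonneg (hE : ¬ ContainsEllOneSublattice E)
    (hB : ∀ x y, 0 ≤ x → 0 ≤ y → 0 ≤ B x y)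
    (hz : IsBidualLimit {x : E | 0 ≤ x ∧ ‖x‖ ≤ M} z)
    {M' : ℝ} (hw : IsBidualLimit {x : E | 0 ≤ x ∧ ‖x‖ ≤ M'} w) :
    z (w ∘L B) = w (z ∘L B.flip) :=
  le_antisymm (bidual_le_of_nonneg hE hB hz hw)
    (bidual_le_of_nonneg (B := B.flip) hE (fun x y hx hy => hB y x hy hx) hw hz)

/-- Positive bilinear forms on a Banach lattice without `ℓ₁`-sublattices are Arens regular. -/
theorem isArensRegular_of_not_containsEllOneSublattice (hE : ¬ ContainsEllOneSublattice E)
    (A : E →ₗ[ℝ] E →ₗ[ℝ] ℝ) (hA : ∀ x y : E, 0 ≤ x → 0 ≤ y → 0 ≤ A x y) : IsArensRegular A := by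
  obtain ⟨B, hBA⟩ := exists_continuous_bilinear_eq A hA
  have hB : ∀ x y, 0 ≤ x → 0 ≤ y → 0 ≤ B x y := fun x y hx hy => by
    rw [hBA]; exact hA x y hx hy
  refine isArensRegular_of_eq hBA fun z w => ?_
  obtain ⟨M, p, q, rfl, hp, hq⟩ := exists_sub_of_bidual z
  obtain ⟨M', r, s, rfl, hr, hs⟩ := exists_sub_of_bidual w
  have h1 : (r - s) ∘L B = r ∘L B - s ∘L B := by ext; rfl
  have h2 : (p - q) ∘L B.flip = p ∘L B.flip - q ∘L B.flip := by ext; rfl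
  rw [h1, h2, map_sub, map_sub, _root_.sub_apply, _root_.sub_apply, _root_.sub_apply,
    _root_.sub_apply, bidual_eq_of_nonneg hE hB hp hr, bidual_eq_of_nonneg hE hB hp hs,
    bidual_eq_of_nonneg hE hB hq hr, bidual_eq_of_nonneg hE hB hq hs]
  ring

/-! ### Order continuity of the dual norm. -/

omit [IsOrderedModule ℝ E] [CompleteSpace E] in
/-- The infimum of a downward directed set of functionals is computed pointwise on the cone. -/
theorem exists_lt_of_isGLB_zero {D : Set (StrongDual ℝ E)} (hD : D.Nonempty)
    (hdir : DirectedOn (· ≥ ·) D) (hglb : IsGLB D 0) {x : E} (hx : 0 ≤ x) {ε : ℝ} (hε : 0 < ε) :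
    ∃ f ∈ D, f x < ε := by
  have : Nonempty D := hD.to_subtype
  have hpos : ∀ f : D, ∀ y : E, 0 ≤ y → 0 ≤ (f : StrongDual ℝ E) y := fun f => hglb.1 f.2
  have hbdd : ∀ y : E, 0 ≤ y → BddBelow (Set.range fun f : D => (f : StrongDual ℝ E) y) :=
    fun y hy => ⟨0, by rintro _ ⟨f, rfl⟩; exact hpos f y hy⟩
  obtain ⟨f₀, hf₀⟩ := hD
  -- Directedness makes the pointwise infimum additive on the cone; it thus extends to a lower bound
  -- of `D`, which must be at most `0`.
  obtain ⟨g, hg⟩ := exists_strongDual_of_additive_on_cone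
    (fun y => ⨅ f : D, (f : StrongDual ℝ E) y) f₀ (by
      intro y t hy ht
      refine le_antisymm ?_ ?_
      · refine le_of_forall_pos_le_add fun δ hδ => ?_
        obtain ⟨a, ha⟩ := exists_lt_of_ciInf_lt
          (lt_add_of_pos_right (⨅ f : D, (f : StrongDual ℝ E) y) (half_pos hδ))
        obtain ⟨b, hb⟩ := exists_lt_of_ciInf_lt
          (lt_add_of_pos_right (⨅ f : D, (f : StrongDual ℝ E) t) (half_pos hδ))
        obtain ⟨c, hc, hca, hcb⟩ := hdir a a.2 b b.2
        have h1 := ciInf_le (hbdd (y + t) (add_nonneg hy ht)) ⟨c, hc⟩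
        have h2 := hca y hy
        have h3 := hcb t ht
        rw [map_add] at h1
        linarith
      · refine le_ciInf fun f => ?_
        rw [map_add]
        exact add_le_add (ciInf_le (hbdd y hy) f) (ciInf_le (hbdd t ht) f))
    (fun y hy => le_ciInf fun f => hpos f y hy)
    (fun y hy => ciInf_le (hbdd y hy) ⟨f₀, hf₀⟩)
  have hg0 : g ≤ 0 := hglb.2 fun f hf y hy => by
    rw [hg y hy]; exact ciInf_le (hbdd y hy) ⟨f, hf⟩
  have h1 := hg0 x hx
  rw [hg x hx, _root_.zero_apply] at h1
  obtain ⟨f, hf⟩ := exists_lt_of_ciInf_lt (h1.trans_lt hε)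
  exact ⟨f, f.2, hf⟩

/-- Pick `u` for `f₀ ∈ D`, then `f₁ ∈ D` small at `u`. Any `f ∈ D` below both satisfies `f x ≤ f₁ u
+ f₀ (x - u)⁺` uniformly on the positive unit ball. -/
theorem hasOrderContinuousNorm_of_not_containsEllOneSublattice
    (hE : ¬ ContainsEllOneSublattice E) : HasOrderContinuousNorm (StrongDual ℝ E) := by
  intro D hD hdir hglb
  have : Nonempty D := hD.to_subtype
  obtain ⟨f₀, hf₀⟩ := id hD
  rw [Metric.tendsto_nhds]
  intro ε hε
  obtain ⟨u, hu, huM⟩ := exists_approx_order_bound hE (hglb.1 hf₀) (by positivity : 0 < ε / 4) 1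
  obtain ⟨f₁, hf₁, hf₁u⟩ := exists_lt_of_isGLB_zero hD hdir hglb hu (by positivity : 0 < ε / 4)
  obtain ⟨f, hf, hff₀, hff₁⟩ := hdir f₀ hf₀ f₁ hf₁
  have hcone : ∀ x, 0 ≤ x → ‖x‖ ≤ 1 → f x ≤ ε / 2 := by
    intro x hx hx1
    have h1 : f x = f (x ⊓ u) + f (x - u)⁺ := by
      rw [posPart_sub_eq_sub_inf, ← map_add, add_sub_cancel]
    have h2 : f (x ⊓ u) ≤ f u := strongDual_mono (hglb.1 hf) inf_le_right
    have h3 := hff₁ u hu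
    have h4 := hff₀ _ (posPart_nonneg (x - u))
    have h5 := huM x hx hx1
    linarith
  have hnorm : ‖f‖ ≤ ε / 2 := by
    refine f.opNorm_le_of_unit_norm (by positivity) fun x hx => ?_
    have h1 := hcone |x| (abs_nonneg x) (by rw [norm_abs_eq_norm, hx])
    rw [Real.norm_eq_abs, abs_le']
    refine ⟨(strongDual_mono (hglb.1 hf) (le_abs_self x)).trans h1, ?_⟩
    rw [← map_neg]
    exact (strongDual_mono (hglb.1 hf) (neg_le_abs x)).trans h1
  filter_upwards [eventually_le_atBot (⟨f, hf⟩ : D)] with g hg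
  have h1 := norm_strongDual_mono (hglb.1 g.2) hg
  rw [Real.dist_eq, sub_zero, abs_of_nonneg (norm_nonneg _)]
  change ‖(g : StrongDual ℝ E)‖ ≤ ‖f‖ at h1
  linarith

end Regularity

theorem proposition1 (E : Type*) [NormedAddCommGroup E] [NormedSpace ℝ E] [CompleteSpace E]
    [Lattice E] [IsOrderedAddMonoid E] [IsOrderedModule ℝ E] [HasSolidNorm E] :
    List.TFAE [
      HasOrderContinuousNorm (StrongDual ℝ E),
      ¬ ContainsEllOneSublattice E,
      ∀ A : E →ₗ[ℝ] E →ₗ[ℝ] ℝ, (∀ x y : E, 0 ≤ x → 0 ≤ y → 0 ≤ A x y) → IsArensRegular A,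
      ∀ T : E →ₗ[ℝ] StrongDual ℝ E, (∀ x : E, 0 ≤ x → 0 ≤ T x) → IsWeaklyCompactOperator T,
      ∀ A : E →ₗ[ℝ] E →ₗ[ℝ] ℝ, (∀ x y : E, 0 ≤ x → 0 ≤ y → 0 ≤ A x y) →
        (∀ x y : E, A x y = A y x) → IsArensRegular A] := by
  tfae_have 1 → 2 := not_containsEllOneSublattice_of_hasOrderContinuousNorm
  tfae_have 2 → 1 := hasOrderContinuousNorm_of_not_containsEllOneSublattice
  tfae_have 2 → 3 := isArensRegular_of_not_containsEllOneSublattice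
  tfae_have 3 → 4 := fun h T hT =>
    isWeaklyCompactOperator_of_isArensRegular
      (h (ContinuousLinearMap.coeLM ℝ ∘ₗ T) fun x y hx hy => hT x hx y hy) T fun _ _ => rfl
  tfae_have 3 → 5 := fun h A hA _ => h A hA
  tfae_have 4 → 2 := not_containsEllOneSublattice_of_weaklyCompact
  tfae_have 5 → 2 := not_containsEllOneSublattice_of_symmetric_regular
  tfae_finish
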